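/- Let $\mathcal{SC}$ be the two-dimensional Swiss-cheese operad (Kontsevich's version), the topological operad with two colours $\mathfrak c$ (closed) and $\mathfrak o$ (open) defined as follows. $\mathcal{SC}(x_1,\dots,x_k;\mathfrak c)$ is empty if $k=0$ or if some $x_i=\mathfrak o$, and otherwise is the space of ordered configurations of $k$ discs in the unit disc of the plane with pairwise disjoint interiors. $\mathcal{SC}(x_1,\dots,x_k;\mathfrak o)$ is empty if $k=0$, and otherwise is the space of ordered configurations, in the unit upper semidisc, of a disc for every $i$ with $x_i=\mathfrak c$ and an upper semidisc centred on the real line for every $i$ with $x_i=\mathfrak o$, with pairwise disjoint interiors (operations with only closed inputs and open output are allowed). Configurations are topologized by centres and radii, the symmetric groups permute the labels, the composite $a\circ_i b$ is obtained by inserting $b$, rescaled, into the $i$-th disc or semidisc of $a$, and the units are the unit disc and the unit upper semidisc. Let $k$ be a field. Let $C(\mathcal{SC})$ be the two-coloured dg operad over $k$ of singular chains of $\mathcal{SC}$ (composition through the Eilenberg–Zilber cross product) and let $H(\mathcal{SC})$ be its homology operad, with zero differential. **Theorem.** For every field $k$, the operad $\mathcal{SC}$ is not formal over $k$: there are no two-coloured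 dg operad $\mathcal P$ over $k$ and morphisms of dg operads $$C(\mathcal{SC})\xleftarrow{\ \gamma\ }\mathcal P\xrightarrow{\ \psi\ }H(\mathcal{SC})$$ that both are quasi-isomorphisms (that is, that induce isomorphisms in homology for all input colours, output colours and degrees). -/

import Mathlib

universe u v w

noncomputable section

/-!
### Ordered chains and the shuffle product

`List V →₀ k` is the free module on the ordered simplices `[v₀, …, vₙ]` with vertices in `V`.
-/

namespace OrderedChains

variable {k : Type u} [CommRing k] {U V W V' W' : Type}

/-- Prepending a vertex to every list of a chain. -/
def consL (v : V) : (List V →₀ k) →ₗ[k] (List V →₀ k) := Finsupp.lmapDomain k k (List.cons v)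

/-- Apply a map of vertices to every list of a chain. -/
def mapL (f : V → W) : (List V →₀ k) →ₗ[k] (List W →₀ k) := Finsupp.lmapDomain k k (List.map f)

/-- The alternating sum `∑ᵢ (-1)ⁱ [v₀, …, v̂ᵢ, …, vₙ]` of the faces of an ordered simplex, augmented:
the empty list is the face of `[v]`. (Singular chains send the empty list to `0`.) -/
def bdry : List V → (List V →₀ k)
  | [] => 0
  | v :: l => Finsupp.single l 1 - consL v (bdry l)

/-- The shuffle product of the ordered simplices `[v₀, …, vₚ]` and `[w₀, …, w_q]`: the sum over all
lattice paths from `(v₀, w₀)` to `(vₚ, w_q)` in the grid, where every step advances exactly one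
of the two coordinates. The sign of a path is `(-1) ^ N`, where `N` is the number of pairs of a
`w`-step and a later `v`-step. The recursion is on the first step: a first `v`-step contributes no
such pair, a first `w`-step contributes one for each of the `p` remaining `v`-steps. -/
def shuf : List V → List W → (List (V × W) →₀ k)
  | [], _ => 0
  | _ :: _, [] => 0
  | [v], [w] => Finsupp.single [(v, w)] 1
  | [v], w :: w' :: ws => consL (v, w) (shuf [v] (w' :: ws))
  | v :: v' :: vs, [w] => consL (v, w) (shuf (v' :: vs) [w])
  | v :: v' :: vs, w :: w' :: ws => consL (v, w)
      (shuf (v' :: vs) (w :: w' :: ws) + (-1 : k) ^ (vs.length + 1) • shuf (v :: v' :: vs) (w' :: ws))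

/-- Bilinear extension of a function of two basis elements. -/
def bilin {A B M : Type*} [AddCommGroup M] [Module k M] (f : A → B → M) :
    (A →₀ k) →ₗ[k] (B →₀ k) →ₗ[k] M :=
  Finsupp.linearCombination k fun a => Finsupp.linearCombination k (f a)

@[simp] theorem bilin_single {A B M : Type*} [AddCommGroup M] [Module k M] (f : A → B → M)
    (a : A) (b : B) : bilin (k := k) f (Finsupp.single a 1) (Finsupp.single b 1) = f a b := by
  simp [bilin]

@[simp] theorem consL_single (v : V) (l : List V) (r : k) :
    consL v (Finsupp.single l r) = Finsupp.single (v :: l) r := by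
  simp [consL]

@[simp] theorem mapL_single (f : V → W) (l : List V) (r : k) :
    mapL f (Finsupp.single l r) = Finsupp.single (l.map f) r := by
  simp [mapL]

theorem mapL_consL (f : V → W) (v : V) (c : List V →₀ k) :
    mapL f (consL v c) = consL (f v) (mapL f c) := by
  induction c using Finsupp.induction_linear with
  | zero => simp
  | add a b ha hb => simp [ha, hb]
  | single l r => simp

/-- The chain `[]` if both lists are empty, else `0`. -/
def aug (l : List V) (m : List W) : List (V × W) →₀ k :=
  match l, m with
  | [], [] => Finsupp.single [] 1
  | _, _ => 0

@[simp] theorem shuf_nil_left (l : List W) : shuf (k := k) ([] : List V) l = 0 := by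
  simp [shuf]

@[simp] theorem shuf_nil_right (l : List V) : shuf (k := k) l ([] : List W) = 0 := by
  cases l <;> simp [shuf]

theorem shuf_cons (v : V) (vs : List V) (w : W) (ws : List W) :
    shuf (k := k) (v :: vs) (w :: ws) = consL (v, w)
      (aug vs ws + shuf vs (w :: ws) + (-1 : k) ^ vs.length • shuf (v :: vs) ws) := by
  rcases vs with _ | ⟨v', vs⟩ <;> rcases ws with _ | ⟨w', ws⟩ <;> simp [shuf, aug]

theorem mapL_aug (f : V → V') (g : W → W') (l : List V) (m : List W) :
    mapL (Prod.map f g) (aug (k := k) l m) = aug (l.map f) (m.map g) := by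
  rcases l with _ | _ <;> rcases m with _ | _ <;> simp [aug]

theorem mapL_shuf (f : V → V') (g : W → W') : ∀ (l : List V) (m : List W),
    mapL (Prod.map f g) (shuf (k := k) l m) = shuf (l.map f) (m.map g)
  | [], _ => by simp
  | _ :: _, [] => by simp
  | v :: vs, w :: ws => by
    simp only [shuf_cons, mapL_consL, map_add, map_smul, mapL_aug, List.map_cons, List.length_map,
      mapL_shuf f g vs (w :: ws), mapL_shuf f g (v :: vs) ws, Prod.map]
  termination_by l m => l.length + m.length

theorem shuf_swap : ∀ (l : List V) (m : List W),
    mapL Prod.swap (shuf (k := k) l m) =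
      (-1 : k) ^ ((l.length - 1) * (m.length - 1)) • shuf m l
  | [], _ => by simp
  | _ :: _, [] => by simp
  | v :: vs, w :: ws => by
    have h1 := shuf_swap vs (w :: ws)
    have h2 := shuf_swap (v :: vs) ws
    rw [shuf_cons, shuf_cons, mapL_consL, map_add (mapL _), map_add (mapL _), map_smul (mapL _), h1, h2]
    have h3 : mapL Prod.swap (aug (k := k) vs ws) = aug ws vs := by
      rcases vs with _ | _ <;> rcases ws with _ | _ <;> simp [aug]
    rw [h3]
    simp only [List.length_cons, Nat.add_sub_cancel, Prod.swap]
    rw [← map_smul (consL _)]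
    congr 1
    have e1 : (-1 : k) ^ (vs.length * ws.length) • aug (k := k) ws vs = aug ws vs := by
      rcases vs with _ | _ <;> rcases ws with _ | _ <;> simp [aug]
    have e2 : (-1 : k) ^ ((vs.length - 1) * ws.length) • shuf (k := k) (w :: ws) vs =
        (-1 : k) ^ (vs.length * ws.length + ws.length) • shuf (w :: ws) vs := by
      rcases vs with _ | ⟨v', vs⟩
      · simp
      · congr 1
        simp only [List.length_cons, Nat.add_sub_cancel]
        rw [show (vs.length + 1) * ws.length + ws.length = vs.length * ws.length + 2 * ws.length by
          ring, pow_add, pow_mul (-1 : k) 2]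
        simp
    have e3 : (-1 : k) ^ (vs.length * (ws.length - 1)) • (-1 : k) ^ vs.length •
          shuf (k := k) ws (v :: vs) =
        (-1 : k) ^ (vs.length * ws.length) • shuf ws (v :: vs) := by
      rcases ws with _ | ⟨w', ws⟩
      · simp
      · rw [smul_smul, ← pow_add]
        simp only [List.length_cons, Nat.add_sub_cancel, mul_add, mul_one]
    rw [smul_add, smul_add, e1, e2, smul_comm ((-1 : k) ^ vs.length), e3, smul_smul, ← pow_add]
    abel
  termination_by l m => l.length + m.length

theorem shuf_singleton_left (v : V) : ∀ l : List W, l ≠ [] →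
    shuf (k := k) [v] l = Finsupp.single (l.map (Prod.mk v)) 1
  | [], h => (h rfl).elim
  | [w], _ => by simp [shuf]
  | w :: w' :: ws, _ => by simp [shuf, shuf_singleton_left v (w' :: ws)]

/-- The chains of lists of length `n`. -/
abbrev ofLen (k : Type u) [CommRing k] (V : Type) (n : ℕ) : Submodule k (List V →₀ k) :=
  Finsupp.supported k k {l | l.length = n}

theorem consL_mem {v : V} {n : ℕ} {c : List V →₀ k} (h : c ∈ ofLen k V n) :
    consL v c ∈ ofLen k V (n + 1) := by
  rw [Finsupp.mem_supported] at h ⊢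
  intro l hl
  classical
  have := Finsupp.mapDomain_support hl
  simp only [Finset.mem_image] at this
  obtain ⟨m, hm, rfl⟩ := this
  simpa using h hm

theorem shuf_mem : ∀ (l : List V) (m : List W),
    shuf (k := k) l m ∈ ofLen k (V × W) (l.length + m.length - 1)
  | [], _ => by simp
  | _ :: _, [] => by simp
  | v :: vs, w :: ws => by
    have h1 := shuf_mem vs (w :: ws)
    have h2 := shuf_mem (v :: vs) ws
    rw [shuf_cons]
    have : (v :: vs).length + (w :: ws).length - 1 = (vs.length + ws.length) + 1 := by
      simp; omega
    rw [this]
    apply consL_mem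
    refine add_mem (add_mem ?_ ?_) (Submodule.smul_mem _ _ ?_)
    · rcases vs with _ | _ <;> rcases ws with _ | _ <;> simp [aug, Finsupp.single_mem_supported]
    · exact h1
    · convert h2 using 2
      simp
  termination_by l m => l.length + m.length

/-- The chain consisting of one list. -/
abbrev bas (k : Type u) [CommRing k] (l : List V) : List V →₀ k := Finsupp.single l 1

/-- Linear extension of `bdry`. -/
abbrev bdryL : (List V →₀ k) →ₗ[k] (List V →₀ k) := Finsupp.linearCombination k bdry

/-- Bilinear extension of `shuf`. -/
abbrev shufL : (List V →₀ k) →ₗ[k] (List W →₀ k) →ₗ[k] (List (V × W) →₀ k) := bilin shuf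

/-- Bilinear extension of `aug`. -/
abbrev augL : (List V →₀ k) →ₗ[k] (List W →₀ k) →ₗ[k] (List (V × W) →₀ k) := bilin aug

theorem bdryL_consL (v : V) (c : List V →₀ k) : bdryL (consL v c) = c - consL v (bdryL c) := by
  induction c using Finsupp.induction_linear with
  | zero => simp
  | add a b ha hb => simp only [map_add, ha, hb]; abel
  | single l r => simp [bdry, smul_sub]

theorem bdryL_bdryL (c : List V →₀ k) : bdryL (bdryL c) = 0 := by
  have : ∀ l : List V, bdryL (bdry (k := k) l) = 0 := by
    intro l
    induction l with
    | nil => simp [bdry]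
    | cons v l ih => rw [bdry, map_sub, bdryL_consL, ih]; simp
  induction c using Finsupp.induction_linear with
  | zero => simp
  | add a b ha hb => simp only [map_add, ha, hb]; simp
  | single l r => simp [this]

theorem shufL_cons_right (v : V) (vs : List V) (w : W) (c : List W →₀ k) :
    shufL (Finsupp.single (v :: vs) 1) (consL w c) = consL (v, w)
      (bilin aug (Finsupp.single vs 1) c + shufL (Finsupp.single vs 1) (consL w c)
        + (-1 : k) ^ vs.length • shufL (Finsupp.single (v :: vs) 1) c) := by
  induction c using Finsupp.induction_linear with
  | zero => simp
  | add a b ha hb => simp only [map_add, ha, hb, smul_add]; abel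
  | single l r =>
    rw [show (Finsupp.single l r : List W →₀ k) = r • Finsupp.single l 1 by simp]
    simp only [map_smul, consL_single, bilin_single, shuf_cons, map_add, smul_add]
    rw [smul_comm r]

theorem shufL_cons_left (n : ℕ) (v : V) (w : W) (ws : List W) (c : List V →₀ k)
    (hc : c ∈ ofLen k V n) :
    shufL (consL v c) (Finsupp.single (w :: ws) 1) = consL (v, w)
      (bilin aug c (Finsupp.single ws 1) + shufL c (Finsupp.single (w :: ws) 1)
        + (-1 : k) ^ n • shufL (consL v c) (Finsupp.single ws 1)) := by
  rw [ofLen, Finsupp.supported_eq_span_single] at hc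
  induction hc using Submodule.span_induction with
  | zero => simp
  | add a b _ _ ha hb =>
    simp only [map_add, LinearMap.add_apply, ha, hb, smul_add]; abel
  | smul r x _ hx =>
    simp only [map_smul, LinearMap.smul_apply, hx]
    rw [smul_comm _ r, ← smul_add, ← smul_add, map_smul]
  | mem x h =>
    obtain ⟨l, hl, rfl⟩ := h
    have hl : l.length = n := hl
    subst hl
    simp [shuf_cons]

theorem bdry_mem (k : Type u) [CommRing k] : ∀ l : List V, bdry (k := k) l ∈ ofLen k V (l.length - 1)
  | [] => by simp [bdry]
  | [v] => by simp [bdry, Finsupp.single_mem_supported]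
  | v :: v' :: l => by
    have h := consL_mem (v := v) (bdry_mem k (v' :: l))
    rw [bdry]
    refine sub_mem ?_ ?_
    · simp [Finsupp.single_mem_supported]
    · simpa using h

/-- The chain `[]` if both lists have one element, else `0`. -/
def aug₁ (l : List V) (m : List W) : List (V × W) →₀ k :=
  match l, m with
  | [_], [_] => bas k []
  | _, _ => 0

theorem aug₁_cons (v : V) (vs : List V) (w : W) (ws : List W) :
    aug₁ (k := k) (v :: vs) (w :: ws) = aug vs ws := by
  rcases vs with _ | _ <;> rcases ws with _ | _ <;> simp [aug, aug₁]

theorem aug_cons_left (v : V) (c : List V →₀ k) (m : List W →₀ k) :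
    augL (consL v c) m = 0 := by
  induction c using Finsupp.induction_linear with
  | zero => simp
  | add a b ha hb => simp [ha, hb]
  | single l r =>
    induction m using Finsupp.induction_linear with
    | zero => simp
    | add a b ha hb => rw [map_add, ha, hb]; simp
    | single => simp [bilin, aug]

theorem aug_cons_right (v : W) (c : List W →₀ k) (m : List V →₀ k) :
    augL m (consL v c) = 0 := by
  induction c using Finsupp.induction_linear with
  | zero => simp
  | add a b ha hb => simp [ha, hb]
  | single l r =>
    induction m using Finsupp.induction_linear with
    | zero => simp
    | add a b ha hb => rw [map_add, LinearMap.add_apply, ha, hb]; simp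
    | single => simp [bilin, aug]

theorem aug_bdry_left (vs : List V) (w : W) (ws : List W) :
    augL (bdry (k := k) vs) (bas k ws) = aug₁ vs (w :: ws) := by
  rcases vs with _ | ⟨v, vs⟩
  · simp [bdry, aug₁]
  · rw [bdry, map_sub, LinearMap.sub_apply, aug_cons_left, aug₁_cons]; simp

theorem aug_bdry_right (v : V) (vs : List V) (ws : List W) :
    augL (bas k vs) (bdry (k := k) ws) = aug₁ (v :: vs) ws := by
  rcases ws with _ | ⟨w, ws⟩
  · simp [bdry, aug₁]
  · rw [bdry, map_sub, aug_cons_right, aug₁_cons]; simp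

theorem bdryL_aug (l : List V) (m : List W) : bdryL (aug (k := k) l m) = 0 := by
  rcases l with _ | _ <;> rcases m with _ | _ <;> simp [aug, bdry]

theorem shufL_nil_left (c : List W →₀ k) : shufL (bas k ([] : List V)) c = 0 := by
  induction c using Finsupp.induction_linear with
  | zero => simp
  | add a b ha hb => rw [map_add, ha, hb]; simp
  | single => simp [bilin]

theorem shufL_nil_right (c : List V →₀ k) : shufL c (bas k ([] : List W)) = 0 := by
  induction c using Finsupp.induction_linear with
  | zero => simp
  | add a b ha hb => rw [map_add, LinearMap.add_apply, ha, hb]; simp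
  | single => simp [bilin]

theorem shuf_bdry : ∀ (l : List V) (m : List W),
    bdryL (shuf (k := k) l m) =
      shufL (bdry l) (bas k m) +
      (-1 : k) ^ (l.length - 1) • shufL (bas k l) (bdry m) + aug₁ l m
  | [], m => by simp [bdry, shufL_nil_left, aug₁]
  | v :: vs, [] => by simp [shufL_nil_right, bdry, aug₁]
  | v :: vs, w :: ws => by
    have h1 := shuf_bdry vs (w :: ws)
    have h2 := shuf_bdry (v :: vs) ws
    have s1 : (-1 : k) ^ (vs.length - 1) • shufL (bas k vs) (bdry (w :: ws)) =
        -((-1 : k) ^ vs.length • shufL (bas k vs) (bdry (w :: ws))) := by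
      rcases vs with _ | ⟨v', vs⟩
      · simp [shufL_nil_left]
      · simp [pow_succ]
    have s2 : (-1 : k) ^ (vs.length - 1) • shufL (consL v (bdry vs)) (bas k ws) =
        -((-1 : k) ^ vs.length • shufL (consL v (bdry vs)) (bas k ws)) := by
      rcases vs with _ | ⟨v', vs⟩
      · simp [bdry]
      · simp [pow_succ]
    have ss : (-1 : k) ^ vs.length * (-1 : k) ^ vs.length = 1 := by
      rw [← mul_pow]; simp
    have t1 : shufL (bdry (v :: vs)) (bas k (w :: ws)) =
        shuf vs (w :: ws) - consL (v, w) (aug₁ vs (w :: ws) +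
          shufL (bdry vs) (bas k (w :: ws)) -
          (-1 : k) ^ vs.length • shufL (consL v (bdry vs)) (bas k ws)) := by
      rw [bdry, map_sub, LinearMap.sub_apply, shufL_cons_left _ _ _ _ _ (bdry_mem k vs), s2,
        aug_bdry_left vs w ws, bilin_single, ← sub_eq_add_neg]
    have t2 : shufL (bas k (v :: vs)) (bdry (w :: ws)) =
        shuf (v :: vs) ws - consL (v, w) (aug₁ (v :: vs) ws +
          shufL (bas k vs) (consL w (bdry ws)) +
          (-1 : k) ^ vs.length • shufL (bas k (v :: vs)) (bdry ws)) := by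
      rw [bdry, map_sub, shufL_cons_right, aug_bdry_right v vs ws, bilin_single]
    have t3 : shufL (bas k vs) (bdry (w :: ws)) =
        shuf vs ws - shufL (bas k vs) (consL w (bdry (k := k) ws)) := by
      rw [bdry, map_sub, bilin_single]
    have t4 : shufL (bdry (v :: vs)) (bas k ws) =
        shuf vs ws - shufL (consL v (bdry vs)) (bas k ws) := by
      rw [bdry, map_sub, LinearMap.sub_apply, bilin_single]
    rw [s1, t3] at h1
    rw [t4] at h2
    rw [shuf_cons, bdryL_consL, map_add bdryL, map_add bdryL, map_smul bdryL, bdryL_aug, h1, h2, t1, t2, aug₁_cons]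
    simp only [List.length_cons, Nat.add_sub_cancel]
    generalize (-1 : k) ^ vs.length = s at *
    simp only [map_add, map_sub, map_neg, map_zero, map_smul, smul_add, smul_sub,
      smul_smul, ss, one_smul]
    abel
  termination_by l m => l.length + m.length

theorem bilin_aug_assoc (a : List U) (b : List V) (c : List W) :
    mapL (Equiv.prodAssoc U V W) (augL (aug (k := k) a b) (bas k c)) =
      augL (bas k a) (aug b c) := by
  rcases a with _ | _ <;> rcases b with _ | _ <;> rcases c with _ | _ <;> simp [aug, bilin]

theorem shuf_assoc : ∀ (l : List U) (m : List V) (n : List W),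
    mapL (Equiv.prodAssoc U V W) (shufL (shuf (k := k) l m) (bas k n)) =
      shufL (bas k l) (shuf m n)
  | [], m, n => by simp [shufL_nil_left]
  | _ :: _, [], n => by simp
  | _ :: _, _ :: _, [] => by simp [shufL_nil_right]
  | u :: us, v :: vs, w :: ws => by
    have h1 := shuf_assoc us (v :: vs) (w :: ws)
    have h2 := shuf_assoc (u :: us) vs (w :: ws)
    have h3 := shuf_assoc (u :: us) (v :: vs) ws
    have hm : aug us vs + shuf us (v :: vs) + (-1 : k) ^ us.length • shuf (u :: us) vs ∈
        ofLen k (U × V) (us.length + vs.length) := by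
      refine add_mem (add_mem ?_ ?_) (Submodule.smul_mem _ _ ?_)
      · rcases us with _ | _ <;> rcases vs with _ | _ <;> simp [aug, Finsupp.single_mem_supported]
      · exact shuf_mem us (v :: vs)
      · convert shuf_mem (k := k) (u :: us) vs using 2
        simp
    have e1 : mapL (Equiv.prodAssoc U V W) (augL (shuf us (v :: vs)) (bas k ws)) = 0 := by
      rcases us with _ | _
      · simp
      · rw [shuf_cons, aug_cons_left, map_zero]
    have e2 : mapL (Equiv.prodAssoc U V W) (augL (shuf (u :: us) vs) (bas k ws)) = 0 := by
      rcases vs with _ | _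
      · simp
      · rw [shuf_cons, aug_cons_left, map_zero]
    have e3 : shufL (aug us vs) (bas k (w :: ws)) = 0 := by
      rcases us with _ | _ <;> rcases vs with _ | _ <;> simp [aug, bilin]
    have e4 : shufL (bas k us) (consL (v, w) (aug vs ws + shuf vs (w :: ws) +
        (-1 : k) ^ vs.length • shuf (v :: vs) ws)) = shufL (bas k us) (shuf (v :: vs) (w :: ws)) := by
      rw [shuf_cons]
    have e5 : augL (bas k us) (shuf vs (w :: ws)) = 0 := by
      rcases vs with _ | _
      · simp
      · rw [shuf_cons, aug_cons_right]
    have e6 : augL (bas k us) (shuf (v :: vs) ws) = 0 := by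
      rcases ws with _ | _
      · simp
      · rw [shuf_cons, aug_cons_right]
    have e7 : shufL (bas k (u :: us)) (aug vs ws) = 0 := by
      rcases vs with _ | _ <;> rcases ws with _ | _ <;> simp [aug, bilin]
    rw [shuf_cons (k := k) v vs w ws, shufL_cons_right, e4, ← h1, map_add (augL _), map_add (augL _),
      map_smul (augL _), e5, e6, map_add (shufL _), map_add (shufL _), map_smul (shufL _), e7,
      ← h2, ← h3, ← bilin_aug_assoc]
    rw [shuf_cons (k := k) u us v vs, shufL_cons_left _ _ _ _ _ hm, ← shuf_cons]
    rw [mapL_consL, map_add (mapL _), map_add (mapL _), map_smul (mapL _)]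
    rw [map_add augL, map_add augL, map_smul augL, LinearMap.add_apply, LinearMap.add_apply,
      LinearMap.smul_apply, map_add (mapL _), map_add (mapL _), map_smul (mapL _), e1, e2]
    rw [map_add shufL, map_add shufL, map_smul shufL, LinearMap.add_apply, LinearMap.add_apply,
      LinearMap.smul_apply, map_add (mapL _), map_add (mapL _), map_smul (mapL _), e3]
    simp only [Equiv.prodAssoc_apply, smul_zero, add_zero, map_zero, zero_add, smul_add, smul_smul,
      pow_add]
    congr 1
    abel
  termination_by l m n => l.length + m.length + n.length

end OrderedChains

/-!
### Singular chains and the Eilenberg-Zilber cross product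
-/

namespace SingularChains

open OrderedChains

/-- The standard topological `n`-simplex. -/
abbrev Simplex (n : ℕ) : Type := stdSimplex ℝ (Fin (n + 1))

/-- The affine map of standard simplices with prescribed values on the vertices. -/
def simplexMap {m n : ℕ} (f : Fin (m + 1) → Fin (n + 1)) : C(Simplex m, Simplex n) :=
  ⟨stdSimplex.map f, stdSimplex.continuous_map f⟩

/-- Singular simplices of all dimensions. -/
abbrev Sing (X : Type) [TopologicalSpace X] : Type := Σ n : ℕ, C(Simplex n, X)

variable {k : Type u} [CommRing k] {U V W V' W' : Type}
variable {X Y Z X' Y' : Type} [TopologicalSpace X] [TopologicalSpace Y] [TopologicalSpace Z]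
  [TopologicalSpace X'] [TopologicalSpace Y']

/-- The alternating sum of the faces of a singular simplex. -/
def faceSum (k : Type u) [CommRing k] : Sing X → (Sing X →₀ k)
  | ⟨0, _⟩ => 0
  | ⟨n + 1, s⟩ => ∑ i : Fin (n + 2),
      Finsupp.single ⟨n, s.comp (simplexMap i.succAbove)⟩ ((-1 : k) ^ (i : ℕ))

/-- The differential of the (total) singular chain module. -/
def diff : (Sing X →₀ k) →ₗ[k] (Sing X →₀ k) := Finsupp.linearCombination k (faceSum k)

/-- The chain map induced by a continuous map. -/
def push (f : C(X, Y)) : (Sing X →₀ k) →ₗ[k] (Sing Y →₀ k) :=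
  Finsupp.lmapDomain k k fun s => ⟨s.1, f.comp s.2⟩

/-- For singular simplices `s : Δᵖ → X`, `t : Δ^q → Y` and an ordered simplex with vertices
`(iₗ, jₗ)` in the grid, the singular simplex of `X × Y` which is the affine simplex of `Δᵖ × Δ^q`
with these vertices followed by `s × t`. -/
def pathSimplex (s : Sing X) (t : Sing Y) :
    List (Fin (s.1 + 1) × Fin (t.1 + 1)) → (Sing (X × Y) →₀ k)
  | [] => 0
  | v :: l => Finsupp.single ⟨l.length,
      (s.2.comp (simplexMap fun i => ((v :: l).get i).1)).prodMk
        (t.2.comp (simplexMap fun i => ((v :: l).get i).2))⟩ 1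

/-- The cross product of two singular simplices: the signed sum over the shuffles, that is, over
the lattice paths from `(0, 0)` to `(p, q)`. -/
def crossBasis (s : Sing X) (t : Sing Y) : Sing (X × Y) →₀ k :=
  Finsupp.linearCombination k (pathSimplex s t)
    (shuf (List.finRange (s.1 + 1)) (List.finRange (t.1 + 1)))

/-- The Eilenberg-Zilber cross product `C(X) ⊗ C(Y) → C(X × Y)`. -/
def cross : (Sing X →₀ k) →ₗ[k] (Sing Y →₀ k) →ₗ[k] (Sing (X × Y) →₀ k) := bilin crossBasis

/-- A rule that turns ordered simplices in `V` into singular simplices of `X`, compatibly with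
changes of vertices. -/
structure Realization (V X : Type) [TopologicalSpace X] where
  ev : ∀ n : ℕ, (Fin (n + 1) → V) → C(Simplex n, X)
  ev_comp : ∀ {m n : ℕ} (g : Fin (n + 1) → V) (h : Fin (m + 1) → Fin (n + 1)),
    ev m (g ∘ h) = (ev n g).comp (simplexMap h)

theorem simplexMap_comp {l m n : ℕ} (g : Fin (m + 1) → Fin (n + 1)) (h : Fin (l + 1) → Fin (m + 1)) :
    simplexMap (g ∘ h) = (simplexMap g).comp (simplexMap h) := by
  ext x : 1
  exact (stdSimplex.map_comp_apply h g x).symm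

theorem simplexMap_id {n : ℕ} : simplexMap (id : Fin (n + 1) → Fin (n + 1)) = .id _ := by
  ext x : 1
  exact stdSimplex.map_id_apply x

namespace Realization

/-- A singular simplex `s : Δᵖ → X` realizes ordered simplices in the vertices of `Δᵖ`. -/
def ofSing (s : Sing X) : Realization (Fin (s.1 + 1)) X where
  ev n g := s.2.comp (simplexMap g)
  ev_comp g h := by rw [simplexMap_comp, ContinuousMap.comp_assoc]

/-- Product of realizations. -/
def prod (ρ : Realization V X) (σ : Realization W Y) : Realization (V × W) (X × Y) where
  ev n g := (ρ.ev n fun i => (g i).1).prodMk (σ.ev n fun i => (g i).2)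
  ev_comp g h := by
    ext x : 1
    exact Prod.ext (DFunLike.congr_fun (ρ.ev_comp (fun i => (g i).1) h) x)
      (DFunLike.congr_fun (σ.ev_comp (fun i => (g i).2) h) x)

/-- Change of vertices. -/
def comap (ρ : Realization V X) (f : V' → V) : Realization V' X where
  ev n g := ρ.ev n (f ∘ g)
  ev_comp g h := ρ.ev_comp (f ∘ g) h

/-- Change of spaces. -/
def map (ρ : Realization V X) (f : C(X, X')) : Realization V X' where
  ev n g := f.comp (ρ.ev n g)
  ev_comp g h := by rw [ρ.ev_comp, ContinuousMap.comp_assoc]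

/-- The singular chain of an ordered simplex. -/
def ch (ρ : Realization V X) : List V → (Sing X →₀ k)
  | [] => 0
  | v :: l => Finsupp.single ⟨l.length, ρ.ev l.length (v :: l).get⟩ 1

/-- Linear extension of `ch`. -/
abbrev chL (ρ : Realization V X) : (List V →₀ k) →ₗ[k] (Sing X →₀ k) :=
  Finsupp.linearCombination k ρ.ch

theorem ch_ofFn (ρ : Realization V X) {n : ℕ} (f : Fin (n + 1) → V) :
    ρ.ch (k := k) (List.ofFn f) = Finsupp.single ⟨n, ρ.ev n f⟩ 1 := by
  have key : ∀ (l : List V) (hl : l = List.ofFn f),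
      ρ.ch (k := k) l = Finsupp.single ⟨n, ρ.ev n f⟩ 1 := by
    intro l hl
    rcases l with _ | ⟨v, l⟩
    · simp at hl
    · have hn : l.length = n := by simpa using congrArg List.length hl
      subst hn
      have : (v :: l).get = f := by
        funext i
        have h2 := List.get_of_eq hl i
        rw [h2, List.get_ofFn]
        rfl
      simp only [ch]
      rw [this]
  exact key _ rfl

theorem exists_ofFn (v : V) (l : List V) : ∃ (n : ℕ) (f : Fin (n + 1) → V), v :: l = List.ofFn f :=
  ⟨l.length, (v :: l).get, by simp⟩

theorem ch_map (ρ : Realization V X) (f : V' → V) (l : List V') :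
    ρ.ch (k := k) (l.map f) = (ρ.comap f).ch l := by
  rcases l with _ | ⟨v, l⟩
  · rfl
  · obtain ⟨n, g, hg⟩ := exists_ofFn v l
    rw [hg, List.map_ofFn, ch_ofFn, ch_ofFn]
    rfl

theorem chL_mapL (ρ : Realization V X) (f : V' → V) (c : List V' →₀ k) :
    ρ.chL (mapL f c) = (ρ.comap f).chL c := by
  induction c using Finsupp.induction_linear with
  | zero => simp
  | add a b ha hb => rw [map_add, map_add, map_add, ha, hb]
  | single l r => simp [ch_map]

theorem push_chL (ρ : Realization V X) (f : C(X, X')) (c : List V →₀ k) :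
    push f (ρ.chL c) = (ρ.map f).chL c := by
  induction c using Finsupp.induction_linear with
  | zero => simp
  | add a b ha hb => rw [map_add, map_add, map_add, ha, hb]
  | single l r =>
    rcases l with _ | ⟨v, l⟩
    · simp [ch]
    · simp [ch, push, map]

theorem bdry_ofFn {n : ℕ} (f : Fin (n + 1) → V) :
    bdry (k := k) (List.ofFn f) =
      ∑ i : Fin (n + 1), (-1 : k) ^ (i : ℕ) • bas k (List.ofFn (f ∘ i.succAbove)) := by
  induction n with
  | zero => simp [bdry]
  | succ n ih =>
    conv_rhs => rw [Fin.sum_univ_succ]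
    rw [List.ofFn_succ, bdry, ih (fun i => f i.succ), map_sum, sub_eq_add_neg,
      ← Finset.sum_neg_distrib]
    congr 1
    · simp [Function.comp_def]
    · refine Finset.sum_congr rfl fun i _ => ?_
      rw [map_smul, consL_single, Fin.val_succ, pow_succ, mul_neg_one, neg_smul]
      congr 4
      rw [List.ofFn_succ]
      simp [Function.comp_def]

theorem diff_ch (ρ : Realization V X) (l : List V) :
    diff (ρ.ch (k := k) l) = ρ.chL (bdry l) := by
  rcases l with _ | ⟨v, l⟩
  · simp [ch, bdry]
  · obtain ⟨n, g, hg⟩ := exists_ofFn v l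
    rw [hg, ch_ofFn, bdry_ofFn, map_sum]
    simp only [map_smul, Finsupp.linearCombination_single, one_smul, diff]
    rcases n with _ | n
    · simp [faceSum, ch]
    · simp only [faceSum, ch_ofFn]
      refine Finset.sum_congr rfl fun i _ => ?_
      rw [ρ.ev_comp, Finsupp.smul_single, smul_eq_mul, mul_one]

theorem diff_chL (ρ : Realization V X) (c : List V →₀ k) :
    diff (ρ.chL c) = ρ.chL (bdryL c) := by
  induction c using Finsupp.induction_linear with
  | zero => simp
  | add a b ha hb => rw [map_add, map_add, map_add, map_add, ha, hb]
  | single l r =>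
    have := diff_ch (k := k) ρ l
    simp [this]

theorem pathSimplex_eq (s : Sing X) (t : Sing Y) :
    pathSimplex (k := k) s t = ((ofSing s).prod (ofSing t)).ch := by
  funext l
  rcases l with _ | ⟨v, l⟩ <;> rfl

theorem ch_finRange (s : Sing X) :
    (ofSing s).ch (k := k) (List.finRange (s.1 + 1)) = Finsupp.single s 1 := by
  rw [← List.ofFn_id, ch_ofFn]
  simp [ofSing, simplexMap_id]

theorem cross_chL (ρ : Realization V X) (σ : Realization W Y) (a : List V →₀ k) (b : List W →₀ k) :
    cross (ρ.chL a) (σ.chL b) = (ρ.prod σ).chL (shufL a b) := by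
  have key : ∀ (l : List V) (m : List W), cross (ρ.ch (k := k) l) (σ.ch m) =
      (ρ.prod σ).chL (shuf l m) := by
    intro l m
    rcases l with _ | ⟨v, l⟩
    · simp [ch]
    rcases m with _ | ⟨w, m⟩
    · simp [ch]
    obtain ⟨p, f, hf⟩ := exists_ofFn v l
    obtain ⟨q, g, hg⟩ := exists_ofFn w m
    rw [hf, hg, ch_ofFn, ch_ofFn, cross, bilin_single, crossBasis, pathSimplex_eq]
    have h1 : List.ofFn f = (List.finRange (p + 1)).map f := by
      rw [← List.ofFn_id, List.map_ofFn]; rfl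
    have h2 : List.ofFn g = (List.finRange (q + 1)).map g := by
      rw [← List.ofFn_id, List.map_ofFn]; rfl
    rw [h1, h2, ← mapL_shuf, chL_mapL]
    congr 2
    have : (ofSing ⟨p, ρ.ev p f⟩).prod (ofSing ⟨q, σ.ev q g⟩) = (ρ.prod σ).comap (Prod.map f g) := by
      simp only [prod, ofSing, comap, ← ev_comp]
      rfl
    rw [this]
  induction a using Finsupp.induction_linear with
  | zero => simp
  | add a a' ha hb =>
    rw [map_add, map_add, map_add, LinearMap.add_apply, LinearMap.add_apply, ha, hb, map_add]
  | single l r =>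
    induction b using Finsupp.induction_linear with
    | zero => simp
    | add b b' ha hb => rw [map_add, map_add, map_add, map_add, ha, hb]
    | single m r' =>
      rw [show Finsupp.single l r = r • bas k l by simp,
        show Finsupp.single m r' = r' • bas k m by simp]
      simp only [map_smul, LinearMap.smul_apply, bilin_single, Finsupp.linearCombination_single,
        one_smul, key]

end Realization

open Realization

theorem bilin_ext {A B M : Type*} [AddCommGroup M] [Module k M]
    {f g : (A →₀ k) →ₗ[k] (B →₀ k) →ₗ[k] M}
    (h : ∀ a b, f (Finsupp.single a 1) (Finsupp.single b 1) =
      g (Finsupp.single a 1) (Finsupp.single b 1)) : f = g := by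
  ext a b
  exact h a b

theorem single_eq_chL (s : Sing X) :
    Finsupp.single s (1 : k) = (ofSing s).chL (bas k (List.finRange (s.1 + 1))) := by
  rw [Finsupp.linearCombination_single, one_smul, ch_finRange]

theorem diff_diff (c : Sing X →₀ k) : diff (diff c) = 0 := by
  induction c using Finsupp.induction_linear with
  | zero => simp
  | add a b ha hb => simp only [map_add, ha, hb, add_zero]
  | single s r =>
    rw [show Finsupp.single s r = r • Finsupp.single s 1 by simp, map_smul, map_smul,
      single_eq_chL, diff_chL, diff_chL, bdryL_bdryL]
    simp

theorem diff_push (f : C(X, Y)) (c : Sing X →₀ k) : diff (push f c) = push f (diff c) := by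
  induction c using Finsupp.induction_linear with
  | zero => simp
  | add a b ha hb => simp only [map_add, ha, hb]
  | single s r =>
    rw [show Finsupp.single s r = r • Finsupp.single s 1 by simp]
    simp only [map_smul]
    rw [single_eq_chL, push_chL, diff_chL, diff_chL, push_chL]

theorem push_push (f : C(X, Y)) (g : C(Y, Z)) (c : Sing X →₀ k) :
    push g (push f c) = push (g.comp f) c := by
  induction c using Finsupp.induction_linear with
  | zero => simp
  | add a b ha hb => simp only [map_add, ha, hb]
  | single s r => simp [push, ContinuousMap.comp_assoc]

theorem push_id (c : Sing X →₀ k) : push (.id X) c = c := by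
  induction c using Finsupp.induction_linear with
  | zero => simp
  | add a b ha hb => simp only [map_add, ha, hb]
  | single s r => simp [push]

theorem diff_cross_single (s : Sing X) (t : Sing Y) :
    diff (cross (Finsupp.single s (1 : k)) (Finsupp.single t 1)) =
      cross (diff (Finsupp.single s 1)) (Finsupp.single t 1) +
      (-1 : k) ^ s.1 • cross (Finsupp.single s 1) (diff (Finsupp.single t 1)) := by
  simp only [single_eq_chL, cross_chL, diff_chL, ← map_smul, ← map_add]
  rw [bilin_single, shuf_bdry, map_add]
  have : ((ofSing s).prod (ofSing t)).chL (aug₁ (k := k) (List.finRange (s.1 + 1))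
      (List.finRange (t.1 + 1))) = 0 := by
    generalize List.finRange (s.1 + 1) = l
    generalize List.finRange (t.1 + 1) = m
    rcases l with _ | ⟨_, _ | ⟨_, _⟩⟩ <;> rcases m with _ | ⟨_, _ | ⟨_, _⟩⟩ <;> simp [aug₁, ch]
  rw [this, add_zero]
  simp

theorem push_cross (f : C(X, X')) (g : C(Y, Y')) (a : Sing X →₀ k) (b : Sing Y →₀ k) :
    push (f.prodMap g) (cross a b) = cross (push f a) (push g b) := by
  suffices h : (cross (k := k) (X := X) (Y := Y)).compr₂ (push (f.prodMap g)) =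
      cross.compl₁₂ (push f) (push g) from LinearMap.congr_fun₂ h a b
  refine bilin_ext fun s t => ?_
  simp only [LinearMap.compr₂_apply, LinearMap.compl₁₂_apply]
  rw [single_eq_chL, single_eq_chL, cross_chL, push_chL, push_chL, push_chL, cross_chL]
  rfl

theorem cross_assoc (a : Sing X →₀ k) (b : Sing Y →₀ k) (c : Sing Z →₀ k) :
    push (Homeomorph.prodAssoc X Y Z : C((X × Y) × Z, X × Y × Z)) (cross (cross a b) c) =
      cross a (cross b c) := by
  induction c using Finsupp.induction_linear with
  | zero => simp
  | add c c' h h' => simp only [map_add, h, h']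
  | single w r =>
  induction b using Finsupp.induction_linear with
  | zero => simp
  | add c c' h h' => simp only [map_add, LinearMap.add_apply, h, h']
  | single t r' =>
  induction a using Finsupp.induction_linear with
  | zero => simp
  | add c c' h h' => simp only [map_add, LinearMap.add_apply, h, h']
  | single s r'' =>
    rw [show Finsupp.single s r'' = r'' • Finsupp.single s 1 by simp,
      show Finsupp.single t r' = r' • Finsupp.single t 1 by simp,
      show Finsupp.single w r = r • Finsupp.single w 1 by simp]
    simp only [map_smul, LinearMap.smul_apply]
    congr 3
    rw [single_eq_chL, single_eq_chL, single_eq_chL, cross_chL, cross_chL, cross_chL, cross_chL,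
      push_chL, bilin_single, bilin_single, ← shuf_assoc, chL_mapL]
    rfl

theorem cross_swap (s : Sing X) (t : Sing Y) :
    push (ContinuousMap.prodSwap : C(X × Y, Y × X))
      (cross (Finsupp.single s (1 : k)) (Finsupp.single t 1)) =
      (-1 : k) ^ (s.1 * t.1) • cross (Finsupp.single t 1) (Finsupp.single s 1) := by
  simp only [single_eq_chL, cross_chL, push_chL, ← map_smul, bilin_single]
  have := shuf_swap (k := k) (List.finRange (s.1 + 1)) (List.finRange (t.1 + 1))
  simp only [List.length_finRange, Nat.add_sub_cancel] at this
  rw [← this, chL_mapL]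
  rfl

theorem cross_point_left (s : C(Simplex 0, X)) (x : X) (hx : ∀ p, s p = x) (b : Sing Y →₀ k) :
    cross (Finsupp.single ⟨0, s⟩ 1) b = push ((ContinuousMap.const Y x).prodMk (.id Y)) b := by
  induction b using Finsupp.induction_linear with
  | zero => simp
  | add c c' h h' => simp only [map_add, h, h']
  | single t r =>
    rw [show Finsupp.single t r = r • Finsupp.single t 1 by simp, map_smul, map_smul]
    congr 1
    rw [single_eq_chL, single_eq_chL, cross_chL, push_chL, bilin_single]
    rw [show List.finRange (0 + 1) = [0] from rfl, shuf_singleton_left _ _ (by simp),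
      ← mapL_single, chL_mapL]
    congr 2
    have h : s = ContinuousMap.const _ x := by ext p; exact hx p
    subst h
    rfl

theorem cross_point_right (s : C(Simplex 0, Y)) (y : Y) (hy : ∀ p, s p = y) (b : Sing X →₀ k) :
    cross b (Finsupp.single ⟨0, s⟩ 1) = push ((ContinuousMap.id X).prodMk (.const X y)) b := by
  induction b using Finsupp.induction_linear with
  | zero => simp
  | add c c' h h' => simp only [map_add, LinearMap.add_apply, h, h']
  | single t r =>
    rw [show Finsupp.single t r = r • Finsupp.single t 1 by simp, map_smul, map_smul,
      LinearMap.smul_apply]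
    congr 1
    have h := cross_swap (k := k) ⟨0, s⟩ t
    rw [cross_point_left s y hy, push_push] at h
    simp only [zero_mul, pow_zero, one_smul] at h
    rw [← h]
    rfl

end SingularChains

/-!
### Coloured operads

The operations of an operad with colours `Col` are indexed by a finite set `I` of inputs, the
colours `x : I → Col` of the inputs and the colour `y` of the output. For `I = Fin n` these are the
operations `P(x₁, …, xₙ; y)`, and bijections of `Fin n` give the action of the symmetric group. The
composite `a ∘ᵢ b` has the inputs of `a` other than `i` together with the inputs of `b`.
-/

namespace Operads

variable {Col : Type} {I I' J J' K : Type}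

/-- The colours of the inputs after the inputs `z` are grafted onto the input `i` of `x`. -/
def graft (x : I → Col) (i : I) (z : J → Col) : {s : I // s ≠ i} ⊕ J → Col :=
  Sum.elim (fun s => x s.1) z

/-- Relabelling of the inputs of a composite. -/
def graftCongr (σ : I' ≃ I) (τ : J' ≃ J) (i : I') :
    {s : I' // s ≠ i} ⊕ J' ≃ {s : I // s ≠ σ i} ⊕ J :=
  Equiv.sumCongr (σ.subtypeEquiv fun _ => by simp) τ

/-- The inputs of `(a ∘ᵢ b) ∘ⱼ c` and of `a ∘ᵢ (b ∘ⱼ c)`. -/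
def graftAssoc (K : Type) (i : I) (j : J) :
    {s : {s : I // s ≠ i} ⊕ J // s ≠ Sum.inr j} ⊕ K ≃ {s : I // s ≠ i} ⊕ ({t : J // t ≠ j} ⊕ K) where
  toFun
    | .inl ⟨.inl s, _⟩ => .inl s
    | .inl ⟨.inr t, h⟩ => .inr (.inl ⟨t, fun e => h (congrArg Sum.inr e)⟩)
    | .inr r => .inr (.inr r)
  invFun
    | .inl s => .inl ⟨.inl s, Sum.inl_ne_inr⟩
    | .inr (.inl t) => .inl ⟨.inr t.1, fun e => t.2 (Sum.inr_injective e)⟩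
    | .inr (.inr r) => .inr r
  left_inv := by rintro (⟨s | t, h⟩ | r) <;> rfl
  right_inv := by rintro (s | t | r) <;> rfl

/-- The inputs of `(a ∘ᵢ b) ∘ⱼ c` and of `(a ∘ⱼ c) ∘ᵢ b` for two inputs `i ≠ j` of `a`. -/
def graftComm (J K : Type) {i j : I} (h : i ≠ j) :
    {s : {s : I // s ≠ i} ⊕ J // s ≠ Sum.inl ⟨j, h.symm⟩} ⊕ K ≃
      {s : {s : I // s ≠ j} ⊕ K // s ≠ Sum.inl ⟨i, h⟩} ⊕ J where
  toFun
    | .inl ⟨.inl s, hs⟩ => .inl ⟨.inl ⟨s.1, fun e => hs (congrArg Sum.inl (Subtype.ext e))⟩,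
        fun e => s.2 (congrArg Subtype.val (Sum.inl_injective e))⟩
    | .inl ⟨.inr t, _⟩ => .inr t
    | .inr r => .inl ⟨.inr r, Sum.inr_ne_inl⟩
  invFun
    | .inl ⟨.inl s, hs⟩ => .inl ⟨.inl ⟨s.1, fun e => hs (congrArg Sum.inl (Subtype.ext e))⟩,
        fun e => s.2 (congrArg Subtype.val (Sum.inl_injective e))⟩
    | .inl ⟨.inr t, _⟩ => .inr t
    | .inr r => .inl ⟨.inr r, Sum.inr_ne_inl⟩
  left_inv := by rintro (⟨s | t, h⟩ | r) <;> rfl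
  right_inv := by rintro (⟨s | t, h⟩ | r) <;> rfl

/-- The inputs of `1 ∘ b` and of `b`. -/
def graftUnit (J : Type) : {s : Unit // s ≠ ()} ⊕ J ≃ J where
  toFun
    | .inl s => (s.2 rfl).elim
    | .inr t => t
  invFun := .inr
  left_inv := by rintro (⟨s, h⟩ | t); exacts [(h rfl).elim, rfl]
  right_inv _ := rfl

open Classical in
/-- The inputs of `a ∘ᵢ 1` and of `a`. -/
def unitGraft (i : I) : {s : I // s ≠ i} ⊕ Unit ≃ I where
  toFun
    | .inl s => s.1
    | .inr _ => i
  invFun s := if h : s = i then .inr () else .inl ⟨s, h⟩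
  left_inv := by
    rintro (⟨s, h⟩ | t)
    · simp [h]
    · simp
  right_inv s := by by_cases h : s = i <;> simp [h]

theorem reindex_refl (x : I → Col) : ∀ s, x s = x (Equiv.refl I s) := fun _ => rfl

theorem graft_inl {x : I → Col} {i j : I} {c : Col} (z : J → Col) (hj : x j = c) (h : j ≠ i) :
    graft x i z (.inl ⟨j, h⟩) = c := hj

theorem graft_inr {z : J → Col} {j : J} {c : Col} (x : I → Col) (i : I) (hj : z j = c) :
    graft x i z (.inr j) = c := hj

theorem graft_congr {x : I → Col} {x' : I' → Col} {z : J → Col} {z' : J' → Col} {σ : I' ≃ I}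
    {τ : J' ≃ J} (hσ : ∀ s, x' s = x (σ s)) (hτ : ∀ t, z' t = z (τ t)) (i : I') :
    ∀ s, graft x' i z' s = graft x (σ i) z (graftCongr σ τ i s) := by
  rintro (s | t)
  · exact hσ s.1
  · exact hτ t

theorem graft_assoc (x : I → Col) (i : I) (z : J → Col) (j : J) (r : K → Col) :
    ∀ s, graft (graft x i z) (.inr j) r s = graft x i (graft z j r) (graftAssoc K i j s) := by
  rintro (⟨s | t, h⟩ | r) <;> rfl

theorem graft_comm (x : I → Col) {i j : I} (h : i ≠ j) (z : J → Col) (r : K → Col) :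
    ∀ s, graft (graft x i z) (.inl ⟨j, h.symm⟩) r s =
      graft (graft x j r) (.inl ⟨i, h⟩) z (graftComm J K h s) := by
  rintro (⟨s | t, h⟩ | r) <;> rfl

theorem graft_unit (y : Col) (z : J → Col) :
    ∀ s, graft (fun _ : Unit => y) () z s = z (graftUnit J s) := by
  rintro (⟨s, h⟩ | t)
  · exact (h rfl).elim
  · rfl

theorem unit_graft {x : I → Col} {i : I} {c : Col} (h : x i = c) :
    ∀ s, graft x i (fun _ : Unit => c) s = x (unitGraft i s) := by
  rintro (s | t)
  · rfl
  · exact h.symm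

/-- A topological operad with set of colours `Col`: spaces of operations with an action of the
bijections of the input sets (`act σ h y a` is `a · σ`, with input colours `x' s = x (σ s)`), units
and partial compositions which are equivariant, sequentially and parallelly associative and
unital. -/
structure TopOperad (Col : Type) where
  space : ∀ {I : Type} [Finite I], (I → Col) → Col → TopCat.{0}
  act : ∀ {I I' : Type} [Finite I] [Finite I'] {x : I → Col} {x' : I' → Col} (σ : I' ≃ I)
    (_ : ∀ s, x' s = x (σ s)) (y : Col), C(space x y, space x' y)
  one : ∀ c : Col, space (fun _ : Unit => c) c
  comp : ∀ {I J : Type} [Finite I] [Finite J] {x : I → Col} {z : J → Col} {c : Col} (i : I)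
    (_ : x i = c) (y : Col), C(space x y × space z c, space (graft x i z) y)
  act_refl : ∀ {I : Type} [Finite I] {x : I → Col} {y : Col} (a : space x y),
    act (Equiv.refl I) (reindex_refl x) y a = a
  act_act : ∀ {I I' I'' : Type} [Finite I] [Finite I'] [Finite I''] {x : I → Col} {x' : I' → Col}
    {x'' : I'' → Col} {y : Col} (σ : I' ≃ I) (hσ : ∀ s, x' s = x (σ s)) (τ : I'' ≃ I')
    (hτ : ∀ s, x'' s = x' (τ s)) (a : space x y),
    act τ hτ y (act σ hσ y a) = act (τ.trans σ) (fun s => (hτ s).trans (hσ (τ s))) y a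
  comp_act : ∀ {I I' J J' : Type} [Finite I] [Finite I'] [Finite J] [Finite J'] {x : I → Col}
    {x' : I' → Col} {z : J → Col} {z' : J' → Col} {c y : Col} (σ : I' ≃ I)
    (hσ : ∀ s, x' s = x (σ s)) (τ : J' ≃ J) (hτ : ∀ t, z' t = z (τ t)) (i : I') (h : x' i = c)
    (a : space x y) (b : space z c),
    comp i h y (act σ hσ y a, act τ hτ c b) =
      act (graftCongr σ τ i) (graft_congr hσ hτ i) y (comp (σ i) ((hσ i).symm.trans h) y (a, b))
  comp_assoc : ∀ {I J K : Type} [Finite I] [Finite J] [Finite K] {x : I → Col} {z : J → Col}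
    {r : K → Col} {c e y : Col} (i : I) (hi : x i = c) (j : J) (hj : z j = e)
    (a : space x y) (b : space z c) (f : space r e),
    comp (x := graft x i z) (.inr j) (graft_inr x i hj) y (comp i hi y (a, b), f) =
      act (graftAssoc K i j) (graft_assoc x i z j r) y (comp i hi y (a, comp j hj c (b, f)))
  comp_comm : ∀ {I J K : Type} [Finite I] [Finite J] [Finite K] {x : I → Col} {z : J → Col}
    {r : K → Col} {c e y : Col} (i j : I) (h : i ≠ j) (hi : x i = c) (hj : x j = e)
    (a : space x y) (b : space z c) (f : space r e),
    comp (x := graft x i z) (.inl ⟨j, h.symm⟩) (graft_inl z hj h.symm) y (comp i hi y (a, b), f) =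
      act (graftComm J K h) (graft_comm x h z r) y
        (comp (x := graft x j r) (.inl ⟨i, h⟩) (graft_inl r hi h) y (comp j hj y (a, f), b))
  one_comp : ∀ {J : Type} [Finite J] {z : J → Col} {y : Col} (b : space z y),
    comp (x := fun _ : Unit => y) () rfl y (one y, b) = act (graftUnit J) (graft_unit y z) y b
  comp_one : ∀ {I : Type} [Finite I] {x : I → Col} {y c : Col} (i : I) (h : x i = c)
    (a : space x y), comp i h y (a, one c) = act (unitGraft i) (unit_graft h) y a

/-- A dg operad over `k` with set of colours `Col`, in the same format: chain complexes of
operations graded by `ℤ`, partial compositions of degree zero for which the Leibniz rule holds, and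
the Koszul signs in the Leibniz rule and in the exchange of two parallel compositions. -/
structure DGOperad (Col : Type) (k : Type u) [CommRing k] where
  obj : ∀ {I : Type} [Finite I], (I → Col) → Col → ChainComplex (ModuleCat.{v} k) ℤ
  act : ∀ {I I' : Type} [Finite I] [Finite I'] {x : I → Col} {x' : I' → Col} (σ : I' ≃ I)
    (_ : ∀ s, x' s = x (σ s)) (y : Col) (n : ℤ), (obj x y).X n →ₗ[k] (obj x' y).X n
  one : ∀ c : Col, (obj (fun _ : Unit => c) c).X 0
  comp : ∀ {I J : Type} [Finite I] [Finite J] {x : I → Col} {z : J → Col} {c : Col} (i : I)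
    (_ : x i = c) (y : Col) {p q n : ℤ} (_ : p + q = n),
    (obj x y).X p →ₗ[k] (obj z c).X q →ₗ[k] (obj (graft x i z) y).X n
  d_act : ∀ {I I' : Type} [Finite I] [Finite I'] {x : I → Col} {x' : I' → Col} {y : Col}
    (σ : I' ≃ I) (hσ : ∀ s, x' s = x (σ s)) {m n : ℤ} (_ : n + 1 = m) (a : (obj x y).X m),
    ((obj x' y).d m n).hom (act σ hσ y m a) = act σ hσ y n (((obj x y).d m n).hom a)
  d_one : ∀ c : Col, ((obj (fun _ : Unit => c) c).d 0 (-1)).hom (one c) = 0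
  d_comp : ∀ {I J : Type} [Finite I] [Finite J] {x : I → Col} {z : J → Col} {c y : Col} (i : I)
    (h : x i = c) {p q n p' q' n' : ℤ} (hn : p + q = n) (hp' : p' + 1 = p) (hq' : q' + 1 = q)
    (hn' : n' + 1 = n) (a : (obj x y).X p) (b : (obj z c).X q),
    ((obj (graft x i z) y).d n n').hom (comp i h y hn a b) =
      comp i h y (by omega) (((obj x y).d p p').hom a) b +
        p.negOnePow • comp i h y (by omega) a (((obj z c).d q q').hom b)
  act_refl : ∀ {I : Type} [Finite I] {x : I → Col} {y : Col} {n : ℤ} (a : (obj x y).X n),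
    act (Equiv.refl I) (reindex_refl x) y n a = a
  act_act : ∀ {I I' I'' : Type} [Finite I] [Finite I'] [Finite I''] {x : I → Col} {x' : I' → Col}
    {x'' : I'' → Col} {y : Col} (σ : I' ≃ I) (hσ : ∀ s, x' s = x (σ s)) (τ : I'' ≃ I')
    (hτ : ∀ s, x'' s = x' (τ s)) {n : ℤ} (a : (obj x y).X n),
    act τ hτ y n (act σ hσ y n a) = act (τ.trans σ) (fun s => (hτ s).trans (hσ (τ s))) y n a
  comp_act : ∀ {I I' J J' : Type} [Finite I] [Finite I'] [Finite J] [Finite J'] {x : I → Col}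
    {x' : I' → Col} {z : J → Col} {z' : J' → Col} {c y : Col} (σ : I' ≃ I)
    (hσ : ∀ s, x' s = x (σ s)) (τ : J' ≃ J) (hτ : ∀ t, z' t = z (τ t)) (i : I') (h : x' i = c)
    {p q n : ℤ} (hn : p + q = n) (a : (obj x y).X p) (b : (obj z c).X q),
    comp i h y hn (act σ hσ y p a) (act τ hτ c q b) =
      act (graftCongr σ τ i) (graft_congr hσ hτ i) y n
        (comp (σ i) ((hσ i).symm.trans h) y hn a b)
  comp_assoc : ∀ {I J K : Type} [Finite I] [Finite J] [Finite K] {x : I → Col} {z : J → Col}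
    {r : K → Col} {c e y : Col} (i : I) (hi : x i = c) (j : J) (hj : z j = e)
    {p q l m m' n : ℤ} (hm : p + q = m) (hn : m + l = n) (hm' : q + l = m') (hn' : p + m' = n)
    (a : (obj x y).X p) (b : (obj z c).X q) (f : (obj r e).X l),
    comp (x := graft x i z) (.inr j) (graft_inr x i hj) y hn (comp i hi y hm a b) f =
      act (graftAssoc K i j) (graft_assoc x i z j r) y n
        (comp i hi y hn' a (comp j hj c hm' b f))
  comp_comm : ∀ {I J K : Type} [Finite I] [Finite J] [Finite K] {x : I → Col} {z : J → Col}
    {r : K → Col} {c e y : Col} (i j : I) (h : i ≠ j) (hi : x i = c) (hj : x j = e)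
    {p q l m m' n : ℤ} (hm : p + q = m) (hn : m + l = n) (hm' : p + l = m') (hn' : m' + q = n)
    (a : (obj x y).X p) (b : (obj z c).X q) (f : (obj r e).X l),
    comp (x := graft x i z) (.inl ⟨j, h.symm⟩) (graft_inl z hj h.symm) y hn (comp i hi y hm a b) f =
      (q * l).negOnePow • act (graftComm J K h) (graft_comm x h z r) y n
        (comp (x := graft x j r) (.inl ⟨i, h⟩) (graft_inl r hi h) y hn' (comp j hj y hm' a f) b)
  one_comp : ∀ {J : Type} [Finite J] {z : J → Col} {y : Col} {n : ℤ} (b : (obj z y).X n),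
    comp (x := fun _ : Unit => y) () rfl y (zero_add n) (one y) b =
      act (graftUnit J) (graft_unit y z) y n b
  comp_one : ∀ {I : Type} [Finite I] {x : I → Col} {y c : Col} (i : I) (h : x i = c) {n : ℤ}
    (a : (obj x y).X n),
    comp i h y (add_zero n) a (one c) = act (unitGraft i) (unit_graft h) y n a

end Operads

namespace Operads

open SingularChains CategoryTheory

section Homology

variable {k : Type u} [CommRing k]

/-- The cycles of degree `n`. -/
abbrev cycles (K : ChainComplex (ModuleCat.{v} k) ℤ) (n : ℤ) : Submodule k (K.X n) :=
  LinearMap.ker (K.d n (n - 1)).hom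

/-- The boundaries of degree `n`. -/
abbrev boundaries (K : ChainComplex (ModuleCat.{v} k) ℤ) (n : ℤ) : Submodule k (K.X n) :=
  LinearMap.range (K.d (n + 1) n).hom

/-- The homology of degree `n`: cycles modulo boundaries. -/
abbrev homology (K : ChainComplex (ModuleCat.{v} k) ℤ) (n : ℤ) : Type v :=
  cycles K n ⧸ (boundaries K n).submoduleOf (cycles K n)

theorem d_cycle (K : ChainComplex (ModuleCat.{v} k) ℤ) {m n : ℤ} (h : n + 1 = m) (z : cycles K m) :
    (K.d m n).hom z.1 = 0 := by
  obtain rfl : n = m - 1 := by omega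
  exact z.2

theorem mem_cycles_of {K : ChainComplex (ModuleCat.{v} k) ℤ} {m n : ℤ} (h : n + 1 = m)
    {z : K.X m} (hz : (K.d m n).hom z = 0) : z ∈ cycles K m := by
  obtain rfl : n = m - 1 := by omega
  exact hz

theorem mem_boundaries_of {K : ChainComplex (ModuleCat.{v} k) ℤ} {m n : ℤ} (h : n + 1 = m)
    (z : K.X m) : (K.d m n).hom z ∈ boundaries K n := by
  subst h
  exact ⟨z, rfl⟩

theorem homology_mk_eq_zero {K : ChainComplex (ModuleCat.{v} k) ℤ} {n : ℤ} (z : cycles K n)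
    (h : z.1 ∈ boundaries K n) :
    (Submodule.Quotient.mk z : homology K n) = 0 :=
  (Submodule.Quotient.mk_eq_zero _).2 h

/-- The map on homology induced by linear maps which commute with the differentials. -/
def homologyMap {K : ChainComplex (ModuleCat.{v} k) ℤ} {L : ChainComplex (ModuleCat.{w} k) ℤ}
    (f : ∀ n, K.X n →ₗ[k] L.X n)
    (hf : ∀ {m n : ℤ} (_ : n + 1 = m) (a : K.X m),
      (L.d m n).hom (f m a) = f n ((K.d m n).hom a)) (n : ℤ) :
    homology K n →ₗ[k] homology L n :=
  Submodule.mapQ _ _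
    ((f n).restrict (p := cycles K n) (q := cycles L n) fun z hz => by
      rw [LinearMap.mem_ker] at hz ⊢
      rw [hf (by omega), hz, map_zero])
    (by
      rintro ⟨z, hz⟩ ⟨b, hb⟩
      exact ⟨f (n + 1) b, by rw [hf rfl, hb]; rfl⟩)

/-- The complex with zero differential on a graded module. -/
def zeroComplex (M : ℤ → ModuleCat.{v} k) : ChainComplex (ModuleCat.{v} k) ℤ where
  X := M
  d _ _ := 0

end Homology

namespace DGOperad

variable {Col : Type} {k : Type u} [CommRing k]

/-- Morphisms of dg operads: families of chain maps which are compatible with the relabelling of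
inputs, the units and the compositions. The two operads may live in different universes. -/
structure Hom (P : DGOperad.{u, v} Col k) (Q : DGOperad.{u, w} Col k) where
  app : ∀ {I : Type} [Finite I] (x : I → Col) (y : Col) (n : ℤ),
    (P.obj x y).X n →ₗ[k] (Q.obj x y).X n
  app_d : ∀ {I : Type} [Finite I] (x : I → Col) (y : Col) {m n : ℤ} (_ : n + 1 = m)
    (a : (P.obj x y).X m),
    ((Q.obj x y).d m n).hom (app x y m a) = app x y n (((P.obj x y).d m n).hom a)
  app_act : ∀ {I I' : Type} [Finite I] [Finite I'] {x : I → Col} {x' : I' → Col} {y : Col}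
    (σ : I' ≃ I) (hσ : ∀ s, x' s = x (σ s)) {n : ℤ} (a : (P.obj x y).X n),
    app x' y n (P.act σ hσ y n a) = Q.act σ hσ y n (app x y n a)
  app_one : ∀ c : Col, app (fun _ : Unit => c) c 0 (P.one c) = Q.one c
  app_comp : ∀ {I J : Type} [Finite I] [Finite J] {x : I → Col} {z : J → Col} {c y : Col} (i : I)
    (h : x i = c) {p q n : ℤ} (hn : p + q = n) (a : (P.obj x y).X p) (b : (P.obj z c).X q),
    app (graft x i z) y n (P.comp i h y hn a b) = Q.comp i h y hn (app x y p a) (app z c q b)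

/-- Quasi-isomorphisms: the morphisms which are bijective on homology, for all colours of the
inputs and the output and in every degree. -/
def Hom.IsQuasiIso {P : DGOperad.{u, v} Col k} {Q : DGOperad.{u, w} Col k} (F : P.Hom Q) : Prop :=
  ∀ {I : Type} [Finite I] (x : I → Col) (y : Col) (n : ℤ),
    Function.Bijective (homologyMap (F.app x y) (F.app_d x y) n)

variable (P : DGOperad.{u, v} Col k)

section

variable {I I' J : Type} [Finite I] [Finite I'] [Finite J] {x : I → Col} {x' : I' → Col}
  {z : J → Col}

theorem comp_mem_cycles {c : Col} (i : I) (h : x i = c) (y : Col) {p q n : ℤ} (hn : p + q = n)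
    (a : cycles (P.obj x y) p) (b : cycles (P.obj z c) q) :
    P.comp i h y hn a.1 b.1 ∈ cycles (P.obj (graft x i z) y) n := by
  refine mem_cycles_of (n := n - 1) (by omega) ?_
  rw [P.d_comp i h hn (p' := p - 1) (q' := q - 1) (by omega) (by omega) (by omega),
    d_cycle _ (by omega), d_cycle _ (by omega)]
  simp

/-- The composition of the homology classes of two cycles. -/
def cyclesComp {c : Col} (i : I) (h : x i = c) (y : Col) {p q n : ℤ} (hn : p + q = n) :
    cycles (P.obj x y) p →ₗ[k] cycles (P.obj z c) q →ₗ[k] homology (P.obj (graft x i z) y) n :=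
  LinearMap.mk₂ k
    (fun a b => Submodule.Quotient.mk ⟨P.comp i h y hn a.1 b.1, P.comp_mem_cycles i h y hn a b⟩)
    (fun a a' b => by
      rw [← Submodule.Quotient.mk_add]; congr 1; ext1; simp)
    (fun r a b => by
      rw [← Submodule.Quotient.mk_smul]; congr 1; ext1; simp)
    (fun a b b' => by
      rw [← Submodule.Quotient.mk_add]; congr 1; ext1; simp)
    (fun r a b => by
      rw [← Submodule.Quotient.mk_smul]; congr 1; ext1; simp)

theorem cyclesComp_right {c : Col} (i : I) (h : x i = c) (y : Col) {p q n : ℤ} (hn : p + q = n)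
    (a : cycles (P.obj x y) p) (b : cycles (P.obj z c) q) (hb : b.1 ∈ boundaries (P.obj z c) q) :
    P.cyclesComp i h y hn a b = 0 := by
  refine homology_mk_eq_zero _ ?_
  obtain ⟨b', hb'⟩ := hb
  have := P.d_comp i h (n := n + 1) (p := p) (p' := p - 1) (q' := q) (n' := n)
    (by omega) (by omega) rfl rfl a.1 b'
  rw [d_cycle _ (by omega), map_zero, LinearMap.zero_apply, zero_add, hb'] at this
  have h2 := mem_boundaries_of rfl (P.comp i h y (by omega : p + (q + 1) = n + 1) a.1 b')
  rw [this] at h2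
  rcases Int.units_eq_one_or p.negOnePow with e | e
  · rw [e, one_smul] at h2
    exact h2
  · rw [e, Units.neg_smul, one_smul] at h2
    exact neg_mem_iff.1 h2

theorem cyclesComp_left {c : Col} (i : I) (h : x i = c) (y : Col) {p q n : ℤ} (hn : p + q = n)
    (a : cycles (P.obj x y) p) (b : cycles (P.obj z c) q) (ha : a.1 ∈ boundaries (P.obj x y) p) :
    P.cyclesComp i h y hn a b = 0 := by
  refine homology_mk_eq_zero _ ?_
  obtain ⟨a', ha'⟩ := ha
  have := P.d_comp i h (n := n + 1) (q := q) (q' := q - 1) (n' := n)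
    (by omega) rfl (by omega) rfl a' b.1
  rw [d_cycle (P.obj z c) (by omega), map_zero, smul_zero, add_zero, ha'] at this
  have h2 := mem_boundaries_of rfl (P.comp i h y (by omega : (p + 1) + q = n + 1) a' b.1)
  rw [this] at h2
  exact h2

/-- The composition on homology. -/
def homologyComp {c : Col} (i : I) (h : x i = c) (y : Col) {p q n : ℤ} (hn : p + q = n) :
    homology (P.obj x y) p →ₗ[k] homology (P.obj z c) q →ₗ[k]
      homology (P.obj (graft x i z) y) n :=
  Submodule.liftQ _
    (LinearMap.flip (Submodule.liftQ _ (P.cyclesComp i h y hn).flip fun b hb => by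
      ext a
      exact P.cyclesComp_right i h y hn a b hb))
    fun a ha => by
      refine Submodule.linearMap_qext _ ?_
      ext b : 1
      exact P.cyclesComp_left i h y hn a b ha

theorem homologyComp_mk {c : Col} (i : I) (h : x i = c) (y : Col) {p q n : ℤ} (hn : p + q = n)
    (a : cycles (P.obj x y) p) (b : cycles (P.obj z c) q) :
    P.homologyComp i h y hn (Submodule.Quotient.mk a) (Submodule.Quotient.mk b) =
      Submodule.Quotient.mk ⟨P.comp i h y hn a.1 b.1, P.comp_mem_cycles i h y hn a b⟩ := rfl

/-- The relabelling of inputs on homology. -/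
def homologyAct (σ : I' ≃ I) (hσ : ∀ s, x' s = x (σ s)) (y : Col) (n : ℤ) :
    homology (P.obj x y) n →ₗ[k] homology (P.obj x' y) n :=
  homologyMap (P.act σ hσ y) (P.d_act σ hσ) n

theorem act_mem_cycles (σ : I' ≃ I) (hσ : ∀ s, x' s = x (σ s)) (y : Col) (n : ℤ)
    (a : cycles (P.obj x y) n) : P.act σ hσ y n a.1 ∈ cycles (P.obj x' y) n := by
  rw [LinearMap.mem_ker, P.d_act σ hσ (by omega), d_cycle _ (by omega), map_zero]

theorem homologyAct_mk (σ : I' ≃ I) (hσ : ∀ s, x' s = x (σ s)) (y : Col) (n : ℤ)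
    (a : cycles (P.obj x y) n) :
    P.homologyAct σ hσ y n (Submodule.Quotient.mk a) =
      Submodule.Quotient.mk ⟨P.act σ hσ y n a.1, P.act_mem_cycles σ hσ y n a⟩ := rfl

end

theorem one_mem_cycles (c : Col) : P.one c ∈ cycles (P.obj (fun _ : Unit => c) c) 0 := P.d_one c

section

variable {I I' I'' J J' K : Type} [Finite I] [Finite I'] [Finite I''] [Finite J] [Finite J']
  [Finite K] {x : I → Col} {x' : I' → Col} {x'' : I'' → Col} {z : J → Col} {z' : J' → Col}
  {r : K → Col} {c e y : Col}

theorem homologyAct_refl {n : ℤ} (a : homology (P.obj x y) n) :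
    P.homologyAct (Equiv.refl I) (reindex_refl x) y n a = a := by
  obtain ⟨a, rfl⟩ := Submodule.Quotient.mk_surjective _ a
  rw [homologyAct_mk]
  congr 1; ext1
  exact P.act_refl a.1

theorem homologyAct_act (σ : I' ≃ I) (hσ : ∀ s, x' s = x (σ s)) (τ : I'' ≃ I')
    (hτ : ∀ s, x'' s = x' (τ s)) {n : ℤ} (a : homology (P.obj x y) n) :
    P.homologyAct τ hτ y n (P.homologyAct σ hσ y n a) =
      P.homologyAct (τ.trans σ) (fun s => (hτ s).trans (hσ (τ s))) y n a := by
  obtain ⟨a, rfl⟩ := Submodule.Quotient.mk_surjective _ a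
  rw [homologyAct_mk, homologyAct_mk, homologyAct_mk]
  congr 1; ext1
  exact P.act_act σ hσ τ hτ a.1

theorem homologyComp_act (σ : I' ≃ I) (hσ : ∀ s, x' s = x (σ s)) (τ : J' ≃ J)
    (hτ : ∀ t, z' t = z (τ t)) (i : I') (h : x' i = c)
    {p q n : ℤ} (hn : p + q = n) (a : homology (P.obj x y) p) (b : homology (P.obj z c) q) :
    P.homologyComp i h y hn (P.homologyAct σ hσ y p a) (P.homologyAct τ hτ c q b) =
      P.homologyAct (graftCongr σ τ i) (graft_congr hσ hτ i) y n
        (P.homologyComp (σ i) ((hσ i).symm.trans h) y hn a b) := by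
  obtain ⟨a, rfl⟩ := Submodule.Quotient.mk_surjective _ a
  obtain ⟨b, rfl⟩ := Submodule.Quotient.mk_surjective _ b
  rw [homologyAct_mk, homologyAct_mk, homologyComp_mk, homologyComp_mk, homologyAct_mk]
  congr 1; ext1
  exact P.comp_act σ hσ τ hτ i h hn a.1 b.1

theorem homologyComp_assoc (i : I) (hi : x i = c) (j : J) (hj : z j = e)
    {p q l m m' n : ℤ} (hm : p + q = m) (hn : m + l = n) (hm' : q + l = m') (hn' : p + m' = n)
    (a : homology (P.obj x y) p) (b : homology (P.obj z c) q) (f : homology (P.obj r e) l) :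
    P.homologyComp (x := graft x i z) (.inr j) (graft_inr x i hj) y hn (P.homologyComp i hi y hm a b) f =
      P.homologyAct (graftAssoc K i j) (graft_assoc x i z j r) y n
        (P.homologyComp i hi y hn' a (P.homologyComp j hj c hm' b f)) := by
  obtain ⟨a, rfl⟩ := Submodule.Quotient.mk_surjective _ a
  obtain ⟨b, rfl⟩ := Submodule.Quotient.mk_surjective _ b
  obtain ⟨f, rfl⟩ := Submodule.Quotient.mk_surjective _ f
  rw [homologyComp_mk, homologyComp_mk, homologyComp_mk, homologyComp_mk, homologyAct_mk]
  congr 1; ext1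
  exact P.comp_assoc i hi j hj hm hn hm' hn' a.1 b.1 f.1

theorem homologyComp_comm (i j : I) (h : i ≠ j) (hi : x i = c) (hj : x j = e)
    {p q l m m' n : ℤ} (hm : p + q = m) (hn : m + l = n) (hm' : p + l = m') (hn' : m' + q = n)
    (a : homology (P.obj x y) p) (b : homology (P.obj z c) q) (f : homology (P.obj r e) l) :
    P.homologyComp (x := graft x i z) (.inl ⟨j, h.symm⟩) (graft_inl z hj h.symm) y hn
        (P.homologyComp i hi y hm a b) f =
      (q * l).negOnePow • P.homologyAct (graftComm J K h) (graft_comm x h z r) y n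
        (P.homologyComp (x := graft x j r) (.inl ⟨i, h⟩) (graft_inl r hi h) y hn'
          (P.homologyComp j hj y hm' a f) b) := by
  obtain ⟨a, rfl⟩ := Submodule.Quotient.mk_surjective _ a
  obtain ⟨b, rfl⟩ := Submodule.Quotient.mk_surjective _ b
  obtain ⟨f, rfl⟩ := Submodule.Quotient.mk_surjective _ f
  rw [homologyComp_mk, homologyComp_mk, homologyComp_mk, homologyComp_mk, homologyAct_mk,
    Units.smul_def, ← Submodule.Quotient.mk_smul]
  congr 1; ext1
  exact P.comp_comm i j h hi hj hm hn hm' hn' a.1 b.1 f.1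

theorem homology_one_comp {n : ℤ} (b : homology (P.obj z y) n) :
    P.homologyComp (x := fun _ : Unit => y) () rfl y (zero_add n)
        (Submodule.Quotient.mk ⟨P.one y, P.one_mem_cycles y⟩) b =
      P.homologyAct (graftUnit J) (graft_unit y z) y n b := by
  obtain ⟨b, rfl⟩ := Submodule.Quotient.mk_surjective _ b
  rw [homologyComp_mk, homologyAct_mk]
  congr 1; ext1
  exact P.one_comp b.1

theorem homology_comp_one (i : I) (h : x i = c) {n : ℤ} (a : homology (P.obj x y) n) :
    P.homologyComp i h y (add_zero n) a (Submodule.Quotient.mk ⟨P.one c, P.one_mem_cycles c⟩) =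
      P.homologyAct (unitGraft i) (unit_graft h) y n a := by
  obtain ⟨a, rfl⟩ := Submodule.Quotient.mk_surjective _ a
  rw [homologyComp_mk, homologyAct_mk]
  congr 1; ext1
  exact P.comp_one i h a.1

theorem homology_d_comp (i : I) (h : x i = c) {p q n p' q' : ℤ} (hp : p' + q = n)
    (hq : p + q' = n) (a : homology (P.obj x y) p) (b : homology (P.obj z c) q) :
    0 = P.homologyComp i h y hp 0 b + p.negOnePow • P.homologyComp i h y hq a 0 := by
  rw [map_zero, map_zero, LinearMap.zero_apply, smul_zero, add_zero]

end

/-- The homology operad of a dg operad, with zero differential. -/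
def homologyOperad : DGOperad.{u, v} Col k where
  obj x y := zeroComplex fun n => ModuleCat.of k (homology (P.obj x y) n)
  act := P.homologyAct
  one c := Submodule.Quotient.mk ⟨P.one c, P.one_mem_cycles c⟩
  comp i h y _ _ _ hn := P.homologyComp i h y hn
  d_act σ hσ _ _ _ _ := (map_zero (P.homologyAct σ hσ _ _)).symm
  d_one _ := rfl
  d_comp i h _ _ _ _ _ _ hn hp hq hn' a b :=
    P.homology_d_comp i h (by omega) (by omega) a b
  act_refl := P.homologyAct_refl
  act_act := P.homologyAct_act
  comp_act := P.homologyComp_act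
  comp_assoc := P.homologyComp_assoc
  comp_comm := P.homologyComp_comm
  one_comp := P.homology_one_comp
  comp_one := P.homology_comp_one

end DGOperad

end Operads

namespace SingularChains

open OrderedChains CategoryTheory

variable {k : Type u} [CommRing k]
variable {X Y Z : Type} [TopologicalSpace X] [TopologicalSpace Y] [TopologicalSpace Z]

/-- The singular chains of degree `n`: combinations of singular `n`-simplices. -/
abbrev chains (k : Type u) [CommRing k] (X : Type) [TopologicalSpace X] (n : ℤ) :
    Submodule k (Sing X →₀ k) :=
  Finsupp.supported k k {s | (s.1 : ℤ) = n}

theorem linear_mem {A M : Type*} [AddCommGroup M] [Module k M] {S : Set A} {N : Submodule k M}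
    (f : (A →₀ k) →ₗ[k] M) (hf : ∀ a ∈ S, f (Finsupp.single a 1) ∈ N) {c : A →₀ k}
    (hc : c ∈ Finsupp.supported k k S) : f c ∈ N := by
  rw [Finsupp.supported_eq_span_single] at hc
  have h : Submodule.span k ((fun i => Finsupp.single i (1 : k)) '' S) ≤ N.comap f := by
    rw [Submodule.span_le]
    rintro _ ⟨a, ha, rfl⟩
    exact hf a ha
  exact h hc

theorem diff_mem {m n : ℤ} (h : n + 1 = m) {c : Sing X →₀ k} (hc : c ∈ chains k X m) :
    diff c ∈ chains k X n := by
  refine linear_mem diff ?_ hc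
  rintro ⟨p, s⟩ hs
  have hs : (p : ℤ) = m := hs
  simp only [diff, Finsupp.linearCombination_single, one_smul]
  rcases p with _ | p
  · simp [faceSum]
  · refine Submodule.sum_mem _ fun i _ => Finsupp.single_mem_supported _ _ ?_
    change (p : ℤ) = n
    push_cast at hs
    omega

theorem push_mem (f : C(X, Y)) {n : ℤ} {c : Sing X →₀ k} (hc : c ∈ chains k X n) :
    push f c ∈ chains k Y n := by
  refine linear_mem (push f) ?_ hc
  rintro s hs
  simp only [push, Finsupp.lmapDomain_apply, Finsupp.mapDomain_single]
  exact Finsupp.single_mem_supported _ _ hs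

theorem cross_mem {p q n : ℤ} (h : p + q = n) {a : Sing X →₀ k} {b : Sing Y →₀ k}
    (ha : a ∈ chains k X p) (hb : b ∈ chains k Y q) : cross a b ∈ chains k (X × Y) n := by
  refine linear_mem (N := chains k (X × Y) n) (cross.flip b) (fun s hs => ?_) ha
  refine linear_mem (N := chains k (X × Y) n) (cross (Finsupp.single s 1)) (fun t ht => ?_) hb
  have hs : (s.1 : ℤ) = p := hs
  have ht : (t.1 : ℤ) = q := ht
  rw [cross, bilin_single, crossBasis]
  refine linear_mem _ (fun l hl => ?_) (shuf_mem _ _)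
  have hl : l.length = _ := hl
  simp only [List.length_finRange] at hl
  rw [Finsupp.linearCombination_single, one_smul]
  rcases l with _ | ⟨v, l⟩
  · simp [pathSimplex]
  · refine Finsupp.single_mem_supported _ _ ?_
    change (l.length : ℤ) = n
    simp only [List.length_cons] at hl
    omega

/-- The singular chain complex of a space with coefficients in `k`, graded by `ℤ` (it is zero in
negative degrees). -/
def singularComplex (k : Type u) [CommRing k] (X : Type) [TopologicalSpace X] :
    ChainComplex (ModuleCat.{u} k) ℤ where
  X n := ModuleCat.of k (chains k X n)
  d m n := if h : n + 1 = m then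
      ModuleCat.ofHom ((diff (k := k) (X := X)).restrict fun _ hc => diff_mem h hc) else 0
  shape _ _ h := dif_neg h
  d_comp_d' l m n hl hm := by
    have hl : m + 1 = l := hl
    have hm : n + 1 = m := hm
    rw [dif_pos hl, dif_pos hm]
    ext c : 2
    exact Subtype.ext (diff_diff c.1)

theorem singularComplex_d {m n : ℤ} (h : n + 1 = m) (c : chains k X m) :
    ((singularComplex k X).d m n).hom c = (⟨diff c.1, diff_mem h c.2⟩ : chains k X n) := by
  have : (singularComplex k X).d m n =
      ModuleCat.ofHom ((diff (k := k) (X := X)).restrict fun _ hc => diff_mem h hc) := dif_pos h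
  rw [this]
  rfl

theorem diff_cross {p : ℤ} {a : Sing X →₀ k} (ha : a ∈ chains k X p) (b : Sing Y →₀ k) :
    diff (cross a b) = cross (diff a) b + p.negOnePow • cross a (diff b) := by
  rw [chains, Finsupp.supported_eq_span_single] at ha
  induction ha using Submodule.span_induction with
  | zero => simp
  | add x y _ _ hx hy =>
    simp only [map_add, LinearMap.add_apply, hx, hy, smul_add]; abel
  | smul r x _ hx =>
    simp only [map_smul, LinearMap.smul_apply, hx, smul_add, Units.smul_def]
    rw [smul_comm r]
  | mem x h =>
    obtain ⟨s, hs, rfl⟩ := h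
    have hs : (s.1 : ℤ) = p := hs
    subst hs
    have e : ∀ c : Sing (X × Y) →₀ k, (s.1 : ℤ).negOnePow • c = (-1 : k) ^ s.1 • c := by
      intro c
      rcases Nat.even_or_odd s.1 with h | h
      · rw [Int.negOnePow_even _ (by exact_mod_cast h), h.neg_one_pow, one_smul, one_smul]
      · rw [Int.negOnePow_odd _ (by exact_mod_cast h), h.neg_one_pow, Units.neg_smul, one_smul,
          neg_smul, one_smul]
    rw [e]
    induction b using Finsupp.induction_linear with
    | zero => simp
    | add x y hx hy => simp only [map_add, hx, hy, smul_add]; abel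
    | single t r =>
      rw [show Finsupp.single t r = r • Finsupp.single t 1 by simp]
      simp only [map_smul, diff_cross_single, smul_add]
      rw [smul_comm r]

theorem cross_comm {p q : ℤ} {a : Sing X →₀ k} {b : Sing Y →₀ k} (ha : a ∈ chains k X p)
    (hb : b ∈ chains k Y q) :
    push (ContinuousMap.prodSwap : C(X × Y, Y × X)) (cross a b) =
      (p * q).negOnePow • cross b a := by
  rw [← sub_eq_zero]
  have key : ∀ (s : Sing X) (t : Sing Y), (s.1 : ℤ) = p → (t.1 : ℤ) = q →
      push (ContinuousMap.prodSwap : C(X × Y, Y × X))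
        (cross (Finsupp.single s (1 : k)) (Finsupp.single t 1)) =
      (p * q).negOnePow • cross (Finsupp.single t 1) (Finsupp.single s 1) := by
    intro s t hs ht
    rw [cross_swap, ← hs, ← ht, ← Nat.cast_mul]
    rcases Nat.even_or_odd (s.1 * t.1) with h | h
    · rw [Int.negOnePow_even _ (by exact_mod_cast h), h.neg_one_pow, one_smul, one_smul]
    · rw [Int.negOnePow_odd _ (by exact_mod_cast h), h.neg_one_pow, Units.neg_smul, one_smul,
        neg_smul, one_smul]
  refine linear_mem (N := (⊥ : Submodule k (Sing (Y × X) →₀ k)))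
    ((push ContinuousMap.prodSwap) ∘ₗ (cross.flip b) - ((p * q).negOnePow : ℤ) • cross b)
    (fun s hs => ?_) ha
  refine linear_mem (N := (⊥ : Submodule k (Sing (Y × X) →₀ k)))
    ((push ContinuousMap.prodSwap) ∘ₗ (cross (Finsupp.single s 1)) -
      ((p * q).negOnePow : ℤ) • cross.flip (Finsupp.single s 1)) (fun t ht => ?_) hb
  exact (Submodule.mem_bot k).2 (sub_eq_zero.2 (key s t hs ht))

theorem cross_push_left {X' : Type} [TopologicalSpace X'] (f : C(X, X')) (a : Sing X →₀ k)
    (b : Sing Y →₀ k) : cross (push f a) b = push (f.prodMap (.id Y)) (cross a b) := by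
  rw [push_cross, push_id]

theorem cross_push_right {Y' : Type} [TopologicalSpace Y'] (f : C(Y, Y')) (a : Sing X →₀ k)
    (b : Sing Y →₀ k) : cross a (push f b) = push ((ContinuousMap.id X).prodMap f) (cross a b) := by
  rw [push_cross, push_id]

theorem push_smul_unit (f : C(X, Y)) (r : ℤˣ) (c : Sing X →₀ k) :
    push f (r • c) = r • push f c := by
  rw [Units.smul_def, map_zsmul, ← Units.smul_def]

theorem cross_exchange {q l : ℤ} (a : Sing X →₀ k) {b : Sing Y →₀ k} {f : Sing Z →₀ k}
    (hb : b ∈ chains k Y q) (hf : f ∈ chains k Z l) :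
    cross (cross a b) f = (q * l).negOnePow •
      push ⟨fun u : (X × Z) × Y => ((u.1.1, u.2), u.1.2), by fun_prop⟩ (cross (cross a f) b) := by
  have h1 := cross_assoc a f b
  have h2 := cross_comm hb hf
  have h3 : cross f b = (q * l).negOnePow • push ContinuousMap.prodSwap (cross b f) := by
    rw [h2, smul_smul, Int.units_mul_self, one_smul]
  have h4 : cross (cross a f) b = (q * l).negOnePow •
      push ⟨fun u : (X × Y) × Z => ((u.1.1, u.2), u.1.2), by fun_prop⟩ (cross (cross a b) f) := by
    have h5 : cross (cross a f) b = push ((Homeomorph.prodAssoc X Z Y).symm :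
        C(X × Z × Y, (X × Z) × Y)) (cross a (cross f b)) := by
      rw [← h1, push_push]
      exact (push_id _).symm
    rw [h5, h3, Units.smul_def, map_zsmul, ← Units.smul_def, push_smul_unit, cross_push_right,
      ← cross_assoc, push_push, push_push]
    rfl
  rw [h4, push_smul_unit, smul_smul, Int.units_mul_self, one_smul, push_push]
  exact (push_id _).symm

end SingularChains

namespace Operads

open SingularChains CategoryTheory

namespace TopOperad

variable {Col : Type} (O : TopOperad Col) (k : Type u) [CommRing k]

section

variable {I I' I'' J J' K : Type} [Finite I] [Finite I'] [Finite I''] [Finite J] [Finite J']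
  [Finite K] {x : I → Col} {x' : I' → Col} {x'' : I'' → Col} {z : J → Col} {z' : J' → Col}
  {r : K → Col} {c e y : Col}

/-- The relabelling of inputs on singular chains. -/
def chainAct (σ : I' ≃ I) (hσ : ∀ s, x' s = x (σ s)) (y : Col) (n : ℤ) :
    chains k (O.space x y) n →ₗ[k] chains k (O.space x' y) n :=
  (push (O.act σ hσ y)).restrict fun _ hc => push_mem _ hc

/-- The unit, as a singular chain. -/
def chainOne (c : Col) : chains k (O.space (fun _ : Unit => c) c) 0 :=
  ⟨Finsupp.single ⟨0, .const _ (O.one c)⟩ 1, Finsupp.single_mem_supported _ _ rfl⟩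

/-- The composition on singular chains: the cross product, followed by the composition. -/
def chainComp (i : I) (h : x i = c) (y : Col) {p q n : ℤ} (hn : p + q = n) :
    chains k (O.space x y) p →ₗ[k] chains k (O.space z c) q →ₗ[k]
      chains k (O.space (graft x i z) y) n :=
  LinearMap.mk₂ k
    (fun a b => ⟨push (O.comp i h y) (cross a.1 b.1), push_mem _ (cross_mem hn a.2 b.2)⟩)
    (fun a a' b => Subtype.ext (by simp))
    (fun r a b => Subtype.ext (by simp))
    (fun a b b' => Subtype.ext (by simp))
    (fun r a b => Subtype.ext (by simp))

theorem chainAct_coe (σ : I' ≃ I) (hσ : ∀ s, x' s = x (σ s)) (n : ℤ)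
    (a : chains k (O.space x y) n) :
    (O.chainAct k σ hσ y n a : Sing (O.space x' y) →₀ k) = push (O.act σ hσ y) a.1 := rfl

theorem chainComp_coe (i : I) (h : x i = c) {p q n : ℤ} (hn : p + q = n)
    (a : chains k (O.space x y) p) (b : chains k (O.space z c) q) :
    (O.chainComp k i h y hn a b : Sing (O.space (graft x i z) y) →₀ k) =
      push (O.comp i h y) (cross a.1 b.1) := rfl

theorem chain_d_act (σ : I' ≃ I) (hσ : ∀ s, x' s = x (σ s)) {m n : ℤ} (h : n + 1 = m)
    (a : chains k (O.space x y) m) :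
    ((singularComplex k (O.space x' y)).d m n).hom (O.chainAct k σ hσ y m a) =
      O.chainAct k σ hσ y n (((singularComplex k (O.space x y)).d m n).hom a) := by
  rw [singularComplex_d h, singularComplex_d h]
  exact Subtype.ext (diff_push _ _)

theorem chain_d_one (c : Col) :
    ((singularComplex k (O.space (fun _ : Unit => c) c)).d 0 (-1)).hom (O.chainOne k c) = 0 := by
  rw [singularComplex_d (by norm_num)]
  refine Subtype.ext ?_
  change diff (Finsupp.single _ 1) = 0
  simp [diff, faceSum]

theorem chain_d_comp (i : I) (h : x i = c) {p q n p' q' n' : ℤ} (hn : p + q = n)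
    (hp : p' + 1 = p) (hq : q' + 1 = q) (hn' : n' + 1 = n)
    (a : chains k (O.space x y) p) (b : chains k (O.space z c) q) :
    ((singularComplex k (O.space (graft x i z) y)).d n n').hom (O.chainComp k i h y hn a b) =
      O.chainComp k i h y (by omega : p' + q = n')
          (((singularComplex k (O.space x y)).d p p').hom a) b +
        p.negOnePow • O.chainComp k i h y (by omega : p + q' = n') a
          (((singularComplex k (O.space z c)).d q q').hom b) := by
  rw [singularComplex_d hn', singularComplex_d hp, singularComplex_d hq]
  refine Subtype.ext ?_
  change diff (push (O.comp i h y) (cross a.1 b.1)) = push (O.comp i h y) (cross (diff a.1) b.1) +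
    p.negOnePow • push (O.comp i h y) (cross a.1 (diff b.1))
  rw [diff_push, diff_cross a.2, map_add, push_smul_unit]

theorem chainAct_refl {n : ℤ} (a : chains k (O.space x y) n) :
    O.chainAct k (Equiv.refl I) (reindex_refl x) y n a = a := by
  refine Subtype.ext ?_
  rw [chainAct_coe]
  have : O.act (Equiv.refl I) (reindex_refl x) y = .id _ := by
    ext u : 1
    exact O.act_refl u
  rw [this, push_id]

theorem chainAct_act (σ : I' ≃ I) (hσ : ∀ s, x' s = x (σ s)) (τ : I'' ≃ I')
    (hτ : ∀ s, x'' s = x' (τ s)) {n : ℤ} (a : chains k (O.space x y) n) :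
    O.chainAct k τ hτ y n (O.chainAct k σ hσ y n a) =
      O.chainAct k (τ.trans σ) (fun s => (hτ s).trans (hσ (τ s))) y n a := by
  refine Subtype.ext ?_
  simp only [chainAct_coe, push_push]
  congr 2
  ext u : 1
  exact O.act_act σ hσ τ hτ u

theorem chainComp_act (σ : I' ≃ I) (hσ : ∀ s, x' s = x (σ s)) (τ : J' ≃ J)
    (hτ : ∀ t, z' t = z (τ t)) (i : I') (h : x' i = c)
    {p q n : ℤ} (hn : p + q = n) (a : chains k (O.space x y) p) (b : chains k (O.space z c) q) :
    O.chainComp k i h y hn (O.chainAct k σ hσ y p a) (O.chainAct k τ hτ c q b) =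
      O.chainAct k (graftCongr σ τ i) (graft_congr hσ hτ i) y n
        (O.chainComp k (σ i) ((hσ i).symm.trans h) y hn a b) := by
  refine Subtype.ext ?_
  simp only [chainAct_coe, chainComp_coe, push_push, cross_push_left, cross_push_right]
  congr 2
  ext u : 1
  exact O.comp_act σ hσ τ hτ i h u.1 u.2

theorem chainComp_assoc (i : I) (hi : x i = c) (j : J) (hj : z j = e)
    {p q l m m' n : ℤ} (hm : p + q = m) (hn : m + l = n) (hm' : q + l = m') (hn' : p + m' = n)
    (a : chains k (O.space x y) p) (b : chains k (O.space z c) q) (f : chains k (O.space r e) l) :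
    O.chainComp k (x := graft x i z) (.inr j) (graft_inr x i hj) y hn
        (O.chainComp k i hi y hm a b) f =
      O.chainAct k (graftAssoc K i j) (graft_assoc x i z j r) y n
        (O.chainComp k i hi y hn' a (O.chainComp k j hj c hm' b f)) := by
  refine Subtype.ext ?_
  simp only [chainAct_coe, chainComp_coe, push_push, cross_push_left, cross_push_right,
    ← cross_assoc]
  congr 2
  ext u : 1
  exact O.comp_assoc i hi j hj u.1.1 u.1.2 u.2

theorem chainComp_comm (i j : I) (h : i ≠ j) (hi : x i = c) (hj : x j = e)
    {p q l m m' n : ℤ} (hm : p + q = m) (hn : m + l = n) (hm' : p + l = m') (hn' : m' + q = n)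
    (a : chains k (O.space x y) p) (b : chains k (O.space z c) q) (f : chains k (O.space r e) l) :
    O.chainComp k (x := graft x i z) (.inl ⟨j, h.symm⟩) (graft_inl z hj h.symm) y hn
        (O.chainComp k i hi y hm a b) f =
      (q * l).negOnePow • O.chainAct k (graftComm J K h) (graft_comm x h z r) y n
        (O.chainComp k (x := graft x j r) (.inl ⟨i, h⟩) (graft_inl r hi h) y hn'
          (O.chainComp k j hj y hm' a f) b) := by
  refine Subtype.ext ?_
  rw [Units.smul_def, Submodule.coe_smul_of_tower, ← Units.smul_def]
  simp only [chainAct_coe, chainComp_coe, push_push, cross_push_left]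
  rw [cross_exchange a.1 b.2 f.2, push_smul_unit, push_push]
  congr 3
  ext u : 1
  exact O.comp_comm i j h hi hj u.1.1 u.2 u.1.2

theorem chain_one_comp {n : ℤ} (b : chains k (O.space z y) n) :
    O.chainComp k (x := fun _ : Unit => y) () rfl y (zero_add n) (O.chainOne k y) b =
      O.chainAct k (graftUnit J) (graft_unit y z) y n b := by
  refine Subtype.ext ?_
  rw [chainComp_coe, chainAct_coe]
  rw [chainOne, cross_point_left _ (O.one y) (fun _ => rfl), push_push]
  congr 2
  ext u : 1
  exact O.one_comp u

theorem chain_comp_one (i : I) (h : x i = c) {n : ℤ} (a : chains k (O.space x y) n) :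
    O.chainComp k i h y (add_zero n) a (O.chainOne k c) =
      O.chainAct k (unitGraft i) (unit_graft h) y n a := by
  refine Subtype.ext ?_
  rw [chainComp_coe, chainAct_coe]
  rw [chainOne, cross_point_right _ (O.one c) (fun _ => rfl), push_push]
  congr 2
  ext u : 1
  exact O.comp_one i h u

end

/-- The dg operad of singular chains of a topological operad. -/
def chainOperad : DGOperad.{u, u} Col k where
  obj x y := singularComplex k (O.space x y)
  act := O.chainAct k
  one := O.chainOne k
  comp i h y _ _ _ hn := O.chainComp k i h y hn
  d_act := O.chain_d_act k
  d_one := O.chain_d_one k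
  d_comp := O.chain_d_comp k
  act_refl := O.chainAct_refl k
  act_act := O.chainAct_act k
  comp_act := O.chainComp_act k
  comp_assoc := O.chainComp_assoc k
  comp_comm := O.chainComp_comm k
  one_comp := O.chain_one_comp k
  comp_one := O.chain_comp_one k

/-- Formality over `k`: there is a dg operad `P` and a zig-zag of quasi-isomorphisms of dg operads
`C(O) ← P → H(O)` between the operad of singular chains and its homology operad. -/
def IsFormal : Prop :=
  ∃ (P : DGOperad.{u, v} Col k) (γ : P.Hom (O.chainOperad k))
    (ψ : P.Hom (O.chainOperad k).homologyOperad), γ.IsQuasiIso ∧ ψ.IsQuasiIso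

end TopOperad

end Operads

/-!
### The Swiss-cheese operad
-/

namespace SwissCheese

open Operads

/-- The two colours: `closed` for discs and `opened` (the open colour) for semidiscs. -/
inductive Colour : Type
  | closed : Colour
  | opened : Colour

/-- The (open) disc with centre `p.1` and radius `p.2` for the closed colour, and its part in the
upper half-plane for the open colour. -/
def region : Colour → ℂ × ℝ → Set ℂ
  | .closed, p => Metric.ball p.1 p.2
  | .opened, p => {u ∈ Metric.ball p.1 p.2 | 0 < u.im}

/-- The configurations `f` of nonoverlapping discs and semidiscs, given by their centres and radii:
for the output colour `closed`, at least one disc and no semidisc in the unit disc; for the output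
colour `opened`, at least one disc or semidisc in the unit upper semidisc, with the semidiscs
centred on the real line. -/
structure IsConfiguration {I : Type} (x : I → Colour) (y : Colour) (f : I → ℂ × ℝ) : Prop where
  nonempty : Nonempty I
  closed_inputs : y = .closed → ∀ i, x i = .closed
  radius_pos : ∀ i, 0 < (f i).2
  centre_real : ∀ i, x i = .opened → (f i).1.im = 0
  region_subset : ∀ i, region (x i) (f i) ⊆ region y (0, 1)
  nonoverlapping : ∀ i j, i ≠ j → Disjoint (region (x i) (f i)) (region (x j) (f j))

/-- The centre and the radius of the image of `q` under `u ↦ p.1 + p.2 * u`, the similarity that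
takes the unit disc to the disc `p`. -/
def place (p q : ℂ × ℝ) : ℂ × ℝ := (p.1 + p.2 * q.1, p.2 * q.2)

theorem mem_region_place {p q : ℂ × ℝ} (hp : 0 < p.2) {c : Colour}
    (hc : c = .opened → p.1.im = 0) (u : ℂ) :
    p.1 + p.2 * u ∈ region c (place p q) ↔ u ∈ region c q := by
  have h1 : p.1 + p.2 * u ∈ Metric.ball (place p q).1 (place p q).2 ↔
      u ∈ Metric.ball q.1 q.2 := by
    have e : p.1 + p.2 * u - (p.1 + p.2 * q.1) = p.2 * (u - q.1) := by ring
    simp only [Metric.mem_ball, place, dist_eq_norm]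
    rw [e, norm_mul, Complex.norm_real, Real.norm_eq_abs, abs_of_pos hp]
    exact mul_lt_mul_iff_right₀ hp
  cases c with
  | closed => exact h1
  | opened =>
    have h2 : (p.1 + p.2 * u).im = p.2 * u.im := by simp [hc rfl]
    refine and_congr h1 ?_
    rw [h2, mul_pos_iff_of_pos_left hp]

theorem exists_eq_place (p : ℂ × ℝ) (hp : 0 < p.2) (u : ℂ) : ∃ t : ℂ, u = p.1 + p.2 * t := by
  have : (p.2 : ℂ) ≠ 0 := by exact_mod_cast hp.ne'
  exact ⟨(u - p.1) / p.2, by field_simp; ring⟩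

theorem place_unit (p : ℂ × ℝ) : place p (0, 1) = p := by simp [place]

theorem region_place_subset {p q : ℂ × ℝ} (hp : 0 < p.2) {c y : Colour}
    (hc : c = .opened → p.1.im = 0) (hy : y = .opened → p.1.im = 0)
    (h : region c q ⊆ region y (0, 1)) : region c (place p q) ⊆ region y p := by
  intro u hu
  obtain ⟨t, rfl⟩ := exists_eq_place p hp u
  rw [mem_region_place hp hc] at hu
  have := (mem_region_place (q := (0, 1)) hp hy t).2 (h hu)
  rwa [place_unit] at this

theorem disjoint_region_place {p q q' : ℂ × ℝ} (hp : 0 < p.2) {c c' : Colour}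
    (hc : c = .opened → p.1.im = 0) (hc' : c' = .opened → p.1.im = 0)
    (h : Disjoint (region c q) (region c' q')) :
    Disjoint (region c (place p q)) (region c' (place p q')) := by
  rw [Set.disjoint_left] at h ⊢
  intro u hu hu'
  obtain ⟨t, rfl⟩ := exists_eq_place p hp u
  rw [mem_region_place hp hc] at hu
  rw [mem_region_place hp hc'] at hu'
  exact h hu hu'

/-- The space of configurations, topologized by the centres and radii. -/
abbrev Configuration {I : Type} (x : I → Colour) (y : Colour) : Type :=
  {f : I → ℂ × ℝ // IsConfiguration x y f}

variable {I I' J : Type} {x : I → Colour} {x' : I' → Colour} {z : J → Colour} {c y : Colour}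

theorem IsConfiguration.relabel {f : I → ℂ × ℝ} (hf : IsConfiguration x y f) (σ : I' ≃ I)
    (hσ : ∀ s, x' s = x (σ s)) : IsConfiguration x' y (f ∘ σ) where
  nonempty := ⟨σ.symm hf.nonempty.some⟩
  closed_inputs h i := (hσ i).trans (hf.closed_inputs h _)
  radius_pos i := hf.radius_pos _
  centre_real i h := hf.centre_real _ ((hσ i).symm.trans h)
  region_subset i := by rw [hσ]; exact hf.region_subset _
  nonoverlapping i j h := by
    rw [hσ, hσ]
    exact hf.nonoverlapping _ _ fun e => h (σ.injective e)

theorem isConfiguration_unit (c : Colour) :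
    IsConfiguration (fun _ : Unit => c) c fun _ => (0, 1) where
  nonempty := inferInstance
  closed_inputs h _ := h
  radius_pos _ := one_pos
  centre_real _ _ := rfl
  region_subset _ := le_rfl
  nonoverlapping _ _ h := (h rfl).elim

/-- The composition of configurations: `g`, scaled into the `i`-th disc or semidisc of `f`, replaces
it. -/
def insertAt (i : I) (f : I → ℂ × ℝ) (g : J → ℂ × ℝ) : {s : I // s ≠ i} ⊕ J → ℂ × ℝ :=
  Sum.elim (fun s => f s.1) fun t => place (f i) (g t)

theorem IsConfiguration.insertAt {f : I → ℂ × ℝ} {g : J → ℂ × ℝ} (hf : IsConfiguration x y f)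
    (i : I) (hi : x i = c) (hg : IsConfiguration z c g) :
    IsConfiguration (graft x i z) y (insertAt i f g) := by
  have hr := hf.radius_pos i
  have hc : c = .opened → (f i).1.im = 0 := fun h => hf.centre_real i (hi.trans h)
  have hz : ∀ t, z t = .opened → (f i).1.im = 0 := by
    intro t ht
    refine hc ?_
    cases c with
    | opened => rfl
    | closed =>
      have := hg.closed_inputs rfl t
      rw [ht] at this
      cases this
  have hsub : ∀ t, region (z t) (place (f i) (g t)) ⊆ region (x i) (f i) := fun t => by
    rw [hi]
    exact region_place_subset hr (hz t) hc (hg.region_subset t)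
  refine ⟨⟨.inr hg.nonempty.some⟩, ?_, ?_, ?_, ?_, ?_⟩
  · rintro h (s | t)
    · exact hf.closed_inputs h s.1
    · exact hg.closed_inputs (hi.symm.trans (hf.closed_inputs h i)) t
  · rintro (s | t)
    · exact hf.radius_pos s.1
    · exact mul_pos hr (hg.radius_pos t)
  · rintro (s | t) h
    · exact hf.centre_real s.1 h
    · have h1 : (f i).1.im = 0 := hz t h
      have h2 : (g t).1.im = 0 := hg.centre_real t h
      simp [SwissCheese.insertAt, place, h1, h2]
  · rintro (s | t)
    · exact hf.region_subset s.1
    · exact (hsub t).trans (hf.region_subset i)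
  · rintro (s | t) (s' | t') h
    · exact hf.nonoverlapping _ _ fun e => h (congrArg Sum.inl (Subtype.ext e))
    · exact (hf.nonoverlapping _ _ s.2).mono_right (hsub t')
    · exact (hf.nonoverlapping _ _ s'.2.symm).mono_left (hsub t)
    · exact disjoint_region_place hr (hz t) (hz t')
        (hg.nonoverlapping _ _ fun e => h (congrArg Sum.inr e))

/-- The composition of configurations. -/
def compMap (i : I) (hi : x i = c) (y : Colour) :
    C(Configuration x y × Configuration z c, Configuration (graft x i z) y) where
  toFun u := ⟨insertAt i u.1.1 u.2.1, u.1.2.insertAt i hi u.2.2⟩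
  continuous_toFun := by
    have h1 : ∀ s, Continuous fun u : Configuration x y × Configuration z c => u.1.1 s :=
      fun s => (continuous_apply s).comp (continuous_subtype_val.comp continuous_fst)
    have h2 : ∀ t, Continuous fun u : Configuration x y × Configuration z c => u.2.1 t :=
      fun t => (continuous_apply t).comp (continuous_subtype_val.comp continuous_snd)
    refine Continuous.subtype_mk (continuous_pi ?_) _
    rintro (s | t)
    · exact h1 s.1
    · have e1 := h1 i
      have e2 := h2 t
      exact ((continuous_fst.comp e1).add ((Complex.continuous_ofReal.comp
        (continuous_snd.comp e1)).mul (continuous_fst.comp e2))).prodMk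
        ((continuous_snd.comp e1).mul (continuous_snd.comp e2))

/-- The two-dimensional Swiss-cheese operad, in the version that also has operations with only discs as
inputs and the unit upper semidisc as output. -/
def swissCheese : TopOperad Colour where
  space x y := TopCat.of (Configuration x y)
  act σ hσ y := ⟨fun f => ⟨f.1 ∘ σ, f.2.relabel σ hσ⟩, by
    refine Continuous.subtype_mk (continuous_pi fun s => ?_) _
    exact (continuous_apply (σ s)).comp continuous_subtype_val⟩
  one c := ⟨fun _ => (0, 1), isConfiguration_unit c⟩
  comp i hi y := compMap i hi y
  act_refl a := rfl
  act_act σ hσ τ hτ a := rfl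
  comp_act := by
    intro I I' J J' _ _ _ _ x x' z z' c y σ hσ τ hτ i h a b
    refine Subtype.ext (funext ?_)
    rintro (s | t) <;> rfl
  comp_assoc := by
    intro I J K _ _ _ x z r c e y i hi j hj a b f
    refine Subtype.ext (funext ?_)
    rintro (⟨s | t, h⟩ | t)
    · rfl
    · rfl
    · change place (place (a.1 i) (b.1 j)) (f.1 t) = place (a.1 i) (place (b.1 j) (f.1 t))
      ext1
      · simp only [place]; push_cast; ring
      · simp only [place]; ring
  comp_comm := by
    intro I J K _ _ _ x z r c e y i j h hi hj a b f
    refine Subtype.ext (funext ?_)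
    rintro (⟨s | t, h⟩ | t) <;> rfl
  one_comp := by
    intro J _ z y b
    refine Subtype.ext (funext ?_)
    rintro (⟨s, h⟩ | t)
    · exact (h rfl).elim
    · change place (0, 1) (b.1 t) = b.1 t
      simp [place]
  comp_one := by
    intro I _ x y c i h a
    refine Subtype.ext (funext ?_)
    rintro (s | t)
    · rfl
    · exact place_unit _

end SwissCheese

end

/-!
The Swiss-cheese operad carries a nontrivial Massey product. Let `μ` be an open product (two semidiscs
in the unit semidisc) and let `e` be the operation with one disc as input and open output. In homology
`e` is central for `μ`, because a disc can be moved over a semidisc from its left to its right; so at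
the chain level `μ(e, 1) - μ(1, e)` (`centrality`) is the boundary of a chain `h`. Inserting `e` into the
open input of `h` gives a chain of half turns of two discs around each other, and the sum of `h ∘ e` and
its relabelling by the transposition (`symmComp`) is a cycle which represents the full turn.

If the operad is formal, then `h` can be corrected by a cycle so that it vanishes in the homology operad,
hence the cycle `h ∘ e + (h ∘ e) · τ` is a boundary for suitable representatives `μ`, `e`, `h`
(`exists_symmComp_mem_boundaries`).

On the other hand, the winding number of one disc around the other is a singular cocycle with integral
values (`windCochain`), defined by logarithms along singular simplices; so it vanishes on boundaries. Take
the direction pointing vertically down as the cut of the logarithm. The disc of an element of the domain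
of `h` is never vertically below a point of its semidisc, so the cocycle vanishes on `h ∘ e`. On
`(h ∘ e) · τ` the direction never points up, and the cocycle is the coboundary of a step function that is
determined by which disc is on the left. Hence its value depends only on the boundary of `h`, and it
equals `ε(μ) ε(e)²`, where `ε(e)` is the augmentation and `ε(μ)` counts the configurations with sign `1`
or `-1` according to the order of the two semidiscs (`windCochain_symmComp`). These numbers are
homology invariants, both equal to `1`, so the value is `1`, which is not zero in `k`.
-/

noncomputable section

/-! ### Winding numbers of paths -/

namespace SingularChains

open Complex OrderedChains

/-- The `i`-th vertex of the standard simplex. -/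
abbrev vert {n : ℕ} (i : Fin (n + 1)) : Simplex n := stdSimplex.vertex i

theorem simplexMap_vert {m n : ℕ} (f : Fin (m + 1) → Fin (n + 1)) (i : Fin (m + 1)) :
    simplexMap f (vert i) = vert (f i) := stdSimplex.map_vertex f i

theorem eq_vert_zero (p : Simplex 0) : p = vert 0 := Subsingleton.elim _ _

theorem existsUnique_log {n : ℕ} (g : C(Simplex n, ℂ)) (hg : ∀ p, g p ≠ 0) (p₀ : Simplex n) (e : ℂ)
    (he : exp e = g p₀) : ∃! L : C(Simplex n, ℂ), L p₀ = e ∧ exp ∘ L = g := by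
  have : ContractibleSpace (Simplex n) :=
    (convex_stdSimplex ℝ (Fin (n + 1))).contractibleSpace ⟨_, (vert (0 : Fin (n + 1))).2⟩
  have : LocallyPathConnectedSpace (Simplex n) :=
    (convex_stdSimplex ℝ (Fin (n + 1))).locallyPathConnectedSpace
  exact isCoveringMapOn_exp.existsUnique_continuousMap_lifts g he fun p => hg p

theorem exists_log {n : ℕ} (g : C(Simplex n, ℂ)) (hg : ∀ p, g p ≠ 0) :
    ∃ L : C(Simplex n, ℂ), ∀ p, exp (L p) = g p := by
  obtain ⟨L, hL, -⟩ := existsUnique_log g hg (vert 0) (log (g (vert 0))) (exp_log (hg _))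
  exact ⟨L, fun p => congrFun hL.2 p⟩

open Classical in
/-- The number of full turns of a path `g` around `0`, the end points being joined to `1` in the
plane cut along the negative real axis: if `L` is a continuous logarithm of `g`, then the increment
of `L` exceeds that of the principal logarithm of `g` by `2πi` times this integer. (It is `0` if `g`
has no continuous logarithm.) -/
def wind (g : C(Simplex 1, ℂ)) : ℤ :=
  if h : ∃ m : ℤ, ∃ L : C(Simplex 1, ℂ), (∀ p, exp (L p) = g p) ∧
      L (vert 1) - L (vert 0) = log (g (vert 1)) - log (g (vert 0)) + m * (2 * Real.pi * I)
    then h.choose else 0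

theorem wind_spec (g : C(Simplex 1, ℂ)) (L : C(Simplex 1, ℂ)) (hL : ∀ p, exp (L p) = g p) :
    L (vert 1) - L (vert 0) =
      log (g (vert 1)) - log (g (vert 0)) + wind g * (2 * Real.pi * I) := by
  have hg : ∀ p, g p ≠ 0 := fun p => by rw [← hL]; exact exp_ne_zero _
  have h : ∃ m : ℤ, ∃ L : C(Simplex 1, ℂ), (∀ p, exp (L p) = g p) ∧
      L (vert 1) - L (vert 0) = log (g (vert 1)) - log (g (vert 0)) + m * (2 * Real.pi * I) := by
    obtain ⟨a, ha⟩ := exp_eq_exp_iff_exists_int.1 ((hL (vert 1)).trans (exp_log (hg _)).symm)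
    obtain ⟨b, hb⟩ := exp_eq_exp_iff_exists_int.1 ((hL (vert 0)).trans (exp_log (hg _)).symm)
    refine ⟨a - b, L, hL, ?_⟩
    rw [ha, hb]
    push_cast
    ring
  rw [wind, dif_pos h]
  obtain ⟨L', hL', e⟩ := h.choose_spec
  -- Two continuous logarithms differ by a constant.
  have h0 : exp (L (vert 0) - L' (vert 0)) = 1 := by
    rw [exp_sub, hL, hL', div_self (hg _)]
  obtain ⟨L'', -, hu⟩ := existsUnique_log g hg (vert 0) (L (vert 0)) (hL _)
  have h1 := hu L ⟨rfl, funext hL⟩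
  have h2 := hu (L' + .const _ (L (vert 0) - L' (vert 0))) ⟨by simp, funext fun p => by
    simp [exp_add, h0, hL']⟩
  have h3 := DFunLike.congr_fun (h1.trans h2.symm) (vert 1)
  simp only [ContinuousMap.add_apply, ContinuousMap.const_apply] at h3
  rw [← e, h3]
  ring

theorem wind_eq (g : C(Simplex 1, ℂ)) (L : C(Simplex 1, ℂ)) (hL : ∀ p, exp (L p) = g p) {m : ℤ}
    (h : L (vert 1) - L (vert 0) =
      log (g (vert 1)) - log (g (vert 0)) + m * (2 * Real.pi * I)) : wind g = m := by
  have h1 := (wind_spec g L hL).symm.trans h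
  have h2 := mul_right_cancel₀ two_pi_I_ne_zero (add_left_cancel h1)
  exact_mod_cast h2

/-- The winding of the boundary of a triangle vanishes, since a map of the triangle to `ℂ \ {0}` has
a continuous logarithm. -/
theorem wind_faces (g : C(Simplex 2, ℂ)) (hg : ∀ p, g p ≠ 0) :
    wind (g.comp (simplexMap (0 : Fin 3).succAbove)) -
      wind (g.comp (simplexMap (1 : Fin 3).succAbove)) +
      wind (g.comp (simplexMap (2 : Fin 3).succAbove)) = 0 := by
  obtain ⟨L, hL⟩ := exists_log g hg
  have key : ∀ i : Fin 3, L (vert (i.succAbove 1)) - L (vert (i.succAbove 0)) =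
      log (g (vert (i.succAbove 1))) - log (g (vert (i.succAbove 0))) +
        wind (g.comp (simplexMap i.succAbove)) * (2 * Real.pi * I) := by
    intro i
    have := wind_spec (g.comp (simplexMap i.succAbove)) (L.comp (simplexMap i.succAbove))
      fun p => hL _
    simpa only [ContinuousMap.comp_apply, simplexMap_vert] using this
  have h0 := key 0
  have h1 := key 1
  have h2 := key 2
  rw [show (0 : Fin 3).succAbove (1 : Fin 2) = 2 from rfl,
    show (0 : Fin 3).succAbove (0 : Fin 2) = 1 from rfl] at h0
  rw [show (1 : Fin 3).succAbove (1 : Fin 2) = 2 from rfl,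
    show (1 : Fin 3).succAbove (0 : Fin 2) = 0 from rfl] at h1
  rw [show (2 : Fin 3).succAbove (1 : Fin 2) = 1 from rfl,
    show (2 : Fin 3).succAbove (0 : Fin 2) = 0 from rfl] at h2
  have h3 : ((wind (g.comp (simplexMap (0 : Fin 3).succAbove)) -
      wind (g.comp (simplexMap (1 : Fin 3).succAbove)) +
      wind (g.comp (simplexMap (2 : Fin 3).succAbove)) : ℤ) : ℂ) * (2 * Real.pi * I) = 0 := by
    push_cast
    linear_combination h1 - h0 - h2
  have h4 := (mul_eq_zero.1 h3).resolve_right two_pi_I_ne_zero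
  exact_mod_cast h4

theorem wind_of_slitPlane (g : C(Simplex 1, ℂ)) (hg : ∀ p, g p ∈ slitPlane) : wind g = 0 := by
  refine wind_eq g ⟨fun p => log (g p), g.continuous.clog hg⟩
    (fun p => exp_log (slitPlane_ne_zero (hg p))) ?_
  simp

/-- The number of full turns by which `log (-z) - πi`, the logarithm of `z` that is continuous off the
positive real axis, exceeds the principal logarithm of `z`. -/
def branch (z : ℂ) : ℤ := if 0 ≤ z.im then -1 else 0

theorem log_neg_eq (z : ℂ) (hz : -z ∈ slitPlane) :
    log (-z) = log z + Real.pi * I + branch z * (2 * Real.pi * I) := by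
  have h : arg (-z) = arg z + Real.pi + branch z * (2 * Real.pi) := by
    rcases lt_trichotomy z.im 0 with h | h | h
    · rw [arg_neg_eq_arg_add_pi_of_im_neg h, branch, if_neg (not_le.2 h)]
      simp
    · have hr : z.re < 0 := by
        rcases mem_slitPlane_iff.1 hz with h1 | h1
        · simpa using h1
        · simp [h] at h1
      have h1 : arg (-z) = 0 := by
        rw [arg_eq_zero_iff]
        simp [h, hr.le]
      have h2 : arg z = Real.pi := arg_eq_pi_iff.2 ⟨hr, h⟩
      rw [h1, h2, branch, if_pos h.ge]
      push_cast
      ring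
    · rw [arg_neg_eq_arg_sub_pi_of_im_pos h, branch, if_pos h.le]
      push_cast
      ring
  rw [log, log, h, norm_neg]
  push_cast
  ring

theorem wind_of_neg_slitPlane (g : C(Simplex 1, ℂ)) (hg : ∀ p, -g p ∈ slitPlane) :
    wind g = branch (g (vert 1)) - branch (g (vert 0)) := by
  refine wind_eq g ⟨fun p => log (-g p) + Real.pi * I,
    (g.continuous.neg.clog hg).add continuous_const⟩ (fun p => ?_) ?_
  · change exp (log (-g p) + Real.pi * I) = g p
    rw [exp_add, exp_log (slitPlane_ne_zero (hg p)), exp_pi_mul_I]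
    ring
  · change log (-g (vert 1)) + Real.pi * I - (log (-g (vert 0)) + Real.pi * I) = _
    rw [log_neg_eq _ (hg _), log_neg_eq _ (hg _)]
    push_cast
    ring

/-! ### Cochains of degree zero and one -/

variable {k : Type u} [CommRing k] {X Y Z : Type} [TopologicalSpace X] [TopologicalSpace Y]
  [TopologicalSpace Z]

/-- A function on a space as a singular cochain of degree `0`. -/
def cochainZero (f : X → k) : (Sing X →₀ k) →ₗ[k] k :=
  Finsupp.linearCombination k fun
    | ⟨0, s⟩ => f (s (vert 0))
    | ⟨_ + 1, _⟩ => 0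

/-- The winding number `wind` of the image under `G`, as a singular cochain of degree `1`. -/
def windCochain (k : Type u) [CommRing k] (G : C(X, ℂ)) : (Sing X →₀ k) →ₗ[k] k :=
  Finsupp.linearCombination k fun
    | ⟨1, s⟩ => (wind (G.comp s) : k)
    | _ => 0

@[simp] theorem cochainZero_single (f : X → k) (s : C(Simplex 0, X)) :
    cochainZero f (Finsupp.single ⟨0, s⟩ 1) = f (s (vert 0)) := by
  simp [cochainZero]

@[simp] theorem windCochain_single (G : C(X, ℂ)) (s : C(Simplex 1, X)) :
    windCochain k G (Finsupp.single ⟨1, s⟩ 1) = (wind (G.comp s) : k) := by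
  simp [windCochain]

theorem push_single (f : C(X, Y)) (s : Sing X) :
    push f (Finsupp.single s (1 : k)) = Finsupp.single ⟨s.1, f.comp s.2⟩ 1 := by
  simp [push]

theorem chains_ext {M : Type*} [AddCommGroup M] [Module k M] {n : ℕ}
    {f g : (Sing X →₀ k) →ₗ[k] M}
    (h : ∀ s : C(Simplex n, X), f (Finsupp.single ⟨n, s⟩ 1) = g (Finsupp.single ⟨n, s⟩ 1))
    {c : Sing X →₀ k} (hc : c ∈ chains k X n) : f c = g c := by
  rw [← sub_eq_zero, ← LinearMap.sub_apply, ← Submodule.mem_bot k]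
  refine linear_mem (N := ⊥) (f - g) ?_ hc
  rintro ⟨m, s⟩ hs
  obtain rfl : m = n := by exact_mod_cast (show (m : ℤ) = n from hs)
  rw [Submodule.mem_bot, LinearMap.sub_apply, h, sub_self]

theorem diff_single_one (s : C(Simplex 1, X)) :
    diff (Finsupp.single ⟨1, s⟩ (1 : k)) =
      Finsupp.single ⟨0, .const _ (s (vert 1))⟩ 1 - Finsupp.single ⟨0, .const _ (s (vert 0))⟩ 1 := by
  have h : ∀ i : Fin 2, s.comp (simplexMap (n := 1) (i.succAbove : Fin 1 → Fin 2)) =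
      .const _ (s (vert (i.succAbove 0))) := by
    intro i
    ext p : 1
    rw [eq_vert_zero p, ContinuousMap.comp_apply, simplexMap_vert]
    rfl
  rw [diff, Finsupp.linearCombination_single, one_smul]
  refine (Fin.sum_univ_two _).trans ?_
  rw [h, h, show (0 : Fin 2).succAbove (0 : Fin 1) = 1 from rfl,
    show (1 : Fin 2).succAbove (0 : Fin 1) = 0 from rfl]
  simp [sub_eq_add_neg, Finsupp.single_neg]

theorem diff_of_mem_chains_zero {c : Sing X →₀ k} (hc : c ∈ chains k X 0) : diff c = 0 := by
  refine chains_ext (n := 0) (f := diff) (g := 0) (fun s => ?_) hc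
  simp [diff, faceSum]

theorem cochainZero_diff {f : X → k} (hf : ∀ s : C(Simplex 1, X), f (s (vert 1)) = f (s (vert 0)))
    {c : Sing X →₀ k} (hc : c ∈ chains k X 1) : cochainZero f (diff c) = 0 := by
  refine chains_ext (n := 1) (f := cochainZero f ∘ₗ diff) (g := 0) (fun s => ?_) hc
  rw [LinearMap.comp_apply, diff_single_one, map_sub, cochainZero_single, cochainZero_single]
  simp [hf]

theorem windCochain_diff {G : C(X, ℂ)} (hG : ∀ u, G u ≠ 0) {c : Sing X →₀ k}
    (hc : c ∈ chains k X 2) : windCochain k G (diff c) = 0 := by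
  refine chains_ext (n := 2) (f := windCochain k G ∘ₗ diff) (g := 0) (fun s => ?_) hc
  have h := congrArg (Int.cast : ℤ → k) (wind_faces (G.comp s) fun p => hG _)
  push_cast at h
  have hd : diff (Finsupp.single ⟨2, s⟩ (1 : k)) = ∑ i : Fin 3, (-1 : k) ^ (i : ℕ) •
      Finsupp.single ⟨1, s.comp (simplexMap i.succAbove)⟩ 1 := by
    simp [diff, faceSum]
  rw [LinearMap.comp_apply, hd, Fin.sum_univ_three, map_add, map_add, map_smul, map_smul, map_smul,
    windCochain_single, windCochain_single, windCochain_single, LinearMap.zero_apply, ← h]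
  simp [sub_eq_add_neg, ContinuousMap.comp_assoc]

theorem windCochain_push (f : C(X, Y)) (G : C(Y, ℂ)) {c : Sing X →₀ k} (hc : c ∈ chains k X 1) :
    windCochain k G (push f c) = windCochain k (G.comp f) c := by
  refine chains_ext (n := 1) (f := windCochain k G ∘ₗ push f) (fun s => ?_) hc
  rw [LinearMap.comp_apply, push_single, windCochain_single, windCochain_single,
    ContinuousMap.comp_assoc]

theorem windCochain_of_slitPlane {G : C(X, ℂ)} (hG : ∀ u, G u ∈ slitPlane) {c : Sing X →₀ k}
    (hc : c ∈ chains k X 1) : windCochain k G c = 0 := by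
  refine chains_ext (n := 1) (f := windCochain k G) (g := 0) (fun s => ?_) hc
  rw [windCochain_single, wind_of_slitPlane _ fun p => hG _]
  simp

/-- Off the positive real axis the winding cochain is the coboundary of the branch function. -/
theorem windCochain_of_neg_slitPlane {G : C(X, ℂ)} (hG : ∀ u, -G u ∈ slitPlane) {c : Sing X →₀ k}
    (hc : c ∈ chains k X 1) :
    windCochain k G c = cochainZero (fun u => (branch (G u) : k)) (diff c) := by
  refine chains_ext (n := 1) (f := windCochain k G) (g := cochainZero (fun u => (branch (G u) : k)) ∘ₗ diff) (fun s => ?_) hc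
  rw [windCochain_single, wind_of_neg_slitPlane _ fun p => hG _, LinearMap.comp_apply,
    diff_single_one, map_sub, cochainZero_single, cochainZero_single]
  simp

theorem cochainZero_push (f : C(X, Y)) (h : Y → k) {c : Sing X →₀ k} (hc : c ∈ chains k X 0) :
    cochainZero h (push f c) = cochainZero (h ∘ f) c := by
  refine chains_ext (n := 0) (f := cochainZero h ∘ₗ push f) (fun s => ?_) hc
  rw [LinearMap.comp_apply, push_single, cochainZero_single, cochainZero_single]
  rfl

theorem cochainZero_sub (f g : X → k) {c : Sing X →₀ k} (hc : c ∈ chains k X 0) :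
    cochainZero f c - cochainZero g c = cochainZero (fun u => f u - g u) c := by
  rw [← LinearMap.sub_apply]
  refine chains_ext (n := 0) (fun s => ?_) hc
  simp

theorem cochainZero_cross (f : X → k) (g : Y → k) {a : Sing X →₀ k} {b : Sing Y →₀ k}
    (ha : a ∈ chains k X 0) (hb : b ∈ chains k Y 0) :
    cochainZero (fun w : X × Y => f w.1 * g w.2) (cross a b) =
      cochainZero f a * cochainZero g b := by
  refine chains_ext (n := 0) (f := cochainZero (fun w : X × Y => f w.1 * g w.2) ∘ₗ cross.flip b)
    (g := LinearMap.mulRight k (cochainZero g b) ∘ₗ cochainZero f) (fun s => ?_) ha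
  refine chains_ext (n := 0) (f := cochainZero (fun w : X × Y => f w.1 * g w.2) ∘ₗ cross (Finsupp.single ⟨0, s⟩ 1))
    (g := LinearMap.mulLeft k (cochainZero f (Finsupp.single ⟨0, s⟩ 1)) ∘ₗ cochainZero g)
    (fun t => ?_) hb
  rw [LinearMap.comp_apply, LinearMap.comp_apply,
    cross_point_left s (s (vert 0)) (fun p => by rw [eq_vert_zero p]), push_single]
  simp

/-- The chain of degree `0` at a point. -/
abbrev pointChain (k : Type u) [CommRing k] (u : X) : chains k X 0 :=
  ⟨Finsupp.single ⟨0, .const _ u⟩ 1, Finsupp.single_mem_supported _ _ rfl⟩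

theorem push_cross_pointChain (f : C(X × Y, Z)) (u : X) (v : Y) :
    push f (cross (pointChain k u).1 (pointChain k v).1) = (pointChain k (f (u, v))).1 := by
  rw [cross_point_left _ u fun _ => rfl, push_single, push_single]
  rfl

theorem joined_pointChain {u v : X} (h : Joined u v) :
    ∃ c ∈ chains k X 1, diff c = (pointChain k v).1 - (pointChain k u).1 := by
  obtain ⟨γ⟩ := h
  refine ⟨Finsupp.single ⟨1, γ.toContinuousMap.comp
    (stdSimplexHomeomorphUnitInterval : C(Simplex 1, unitInterval))⟩ 1,
    Finsupp.single_mem_supported _ _ rfl, ?_⟩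
  rw [diff_single_one]
  have h0 : stdSimplexHomeomorphUnitInterval (vert (0 : Fin 2)) = 0 :=
    stdSimplexHomeomorphUnitInterval_zero
  have h1 : stdSimplexHomeomorphUnitInterval (vert (1 : Fin 2)) = 1 :=
    stdSimplexHomeomorphUnitInterval_one
  congr 4
  · simp [h1]
  · simp [h0]

end SingularChains

/-! ### The Massey product obstruction in a dg operad -/

namespace Operads

/-- The bijection between the inputs of the composites of a binary operation `μ` and a unary
operation `e` at the two inputs of `μ`: the input of `e` corresponds to the input of `e`, and the
remaining input of `μ` to the remaining input. -/
def outerSwap : {s : Bool // s ≠ false} ⊕ Unit ≃ {s : Bool // s ≠ true} ⊕ Unit :=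
  Equiv.sumCongr ⟨fun _ => ⟨false, by decide⟩, fun _ => ⟨true, by decide⟩,
    by rintro ⟨_ | _, h⟩; exacts [(h rfl).elim, rfl],
    by rintro ⟨_ | _, h⟩; exacts [rfl, (h rfl).elim]⟩ (Equiv.refl _)

/-- The input of `μ ∘ e` that comes from the input `true` of `μ`. -/
abbrev lastInput : {s : Bool // s ≠ false} ⊕ Unit := .inl ⟨true, Bool.false_ne_true.symm⟩

/-- The set of inputs of `(μ ∘ e) ∘ e`. -/
abbrev TwoInputs : Type := {s : {s : Bool // s ≠ false} ⊕ Unit // s ≠ lastInput} ⊕ Unit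

/-- The input of the first copy of `e` in `(μ ∘ e) ∘ e`; the input of the second one is `.inr ()`. -/
abbrev firstOfTwo : TwoInputs := .inl ⟨.inr (), Sum.inr_ne_inl⟩

/-- The transposition of the two inputs of `(μ ∘ e) ∘ e`. -/
def innerSwap : TwoInputs ≃ TwoInputs where
  toFun
    | .inl _ => .inr ()
    | .inr _ => firstOfTwo
  invFun
    | .inl _ => .inr ()
    | .inr _ => firstOfTwo
  left_inv := by
    rintro (⟨⟨_ | _, h'⟩ | _, h⟩ | _)
    · exact (h' rfl).elim
    · exact (h rfl).elim
    · rfl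
    · rfl
  right_inv := by
    rintro (⟨⟨_ | _, h'⟩ | _, h⟩ | _)
    · exact (h' rfl).elim
    · exact (h rfl).elim
    · rfl
    · rfl

theorem twoInputs_cases {p : TwoInputs → Prop} (h1 : p firstOfTwo) (h2 : p (.inr ())) (s) : p s := by
  rcases s with (⟨⟨_ | _, h'⟩ | _, h⟩ | _)
  · exact (h' rfl).elim
  · exact (h rfl).elim
  · exact h1
  · exact h2

/-- The bijection of the inputs of the two composites `(μ ∘ e) ∘ e` that is induced by `outerSwap`. -/
def outerSwapGraft : TwoInputs ≃
    {s : {s : Bool // s ≠ true} ⊕ Unit // s ≠ Sum.inl ⟨false, Bool.false_ne_true⟩} ⊕ Unit :=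
  graftCongr outerSwap (Equiv.refl Unit) lastInput

theorem innerSwap_trans_graftComm :
    innerSwap.trans (graftComm Unit Unit Bool.false_ne_true) = outerSwapGraft := by
  ext s
  induction s using twoInputs_cases <;> rfl

theorem innerSwap_trans_outerSwapGraft :
    innerSwap.trans outerSwapGraft = graftComm Unit Unit Bool.false_ne_true := by
  ext s
  induction s using twoInputs_cases <;> rfl

variable {Col : Type} {c o : Col}

theorem graft_outerSwap (c o : Col) : ∀ s, graft (fun _ : Bool => o) false (fun _ : Unit => c) s =
    graft (fun _ : Bool => o) true (fun _ : Unit => c) (outerSwap s) := by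
  rintro (_ | _) <;> rfl

theorem graft_lastInput (c o : Col) :
    graft (fun _ : Bool => o) false (fun _ : Unit => c) lastInput = o := rfl

/-- The colours of the inputs of `(μ ∘ e) ∘ e`. -/
abbrev twoColours (c o : Col) : TwoInputs → Col :=
  graft (graft (fun _ : Bool => o) false fun _ : Unit => c) lastInput fun _ : Unit => c

theorem twoColours_innerSwap (c o : Col) :
    ∀ s, twoColours c o s = twoColours c o (innerSwap s) := by
  intro s
  induction s using twoInputs_cases <;> rfl

theorem twoColours_outerSwapGraft (c o : Col) : ∀ s, twoColours c o s =
    graft (graft (fun _ : Bool => o) true fun _ : Unit => c) (.inl ⟨false, Bool.false_ne_true⟩)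
      (fun _ : Unit => c) (outerSwapGraft s) :=
  graft_congr (graft_outerSwap c o) (reindex_refl _) lastInput

namespace DGOperad

variable {k : Type u} [CommRing k] (P : DGOperad.{u, v} Col k)

/-- The commutator `μ(e, 1) - μ(1, e)`, with the inputs of the second term relabelled so that both
terms have the same inputs. It bounds if `e` is central for the product `μ` up to homotopy. -/
def centrality (μ : (P.obj (fun _ : Bool => o) o).X 0) (e : (P.obj (fun _ : Unit => c) o).X 0) :
    (P.obj (graft (fun _ : Bool => o) false fun _ : Unit => c) o).X 0 :=
  P.comp false rfl o (zero_add 0) μ e -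
    P.act outerSwap (graft_outerSwap c o) o 0 (P.comp true rfl o (zero_add 0) μ e)

/-- The symmetrization of `h ∘ e`. If `h` bounds `μ(e, 1) - μ(1, e)`, then this represents a Massey
product of `e`, `μ` and `e`. -/
def symmComp (h : (P.obj (graft (fun _ : Bool => o) false fun _ : Unit => c) o).X 1)
    (e : (P.obj (fun _ : Unit => c) o).X 0) : (P.obj (twoColours c o) o).X 1 :=
  P.comp lastInput (graft_lastInput c o) o (add_zero 1) h e +
    P.act innerSwap (twoColours_innerSwap c o) o 1 (P.comp lastInput (graft_lastInput c o) o (add_zero 1) h e)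

theorem d_deg_zero {K : ChainComplex (ModuleCat.{v} k) ℤ} (z : cycles K 0) :
    (K.d 0 (-1)).hom z.1 = 0 := z.2

/-- If `h` bounds `μ(e, 1) - μ(1, e)`, then the symmetrization of `h ∘ e` is a cycle: the boundary of
`h ∘ e` is the antisymmetric operation `μ(e, e) - μ(e, e) · τ`, where `τ` exchanges the inputs. -/
theorem d_symmComp (μ : (P.obj (fun _ : Bool => o) o).X 0)
    (e : cycles (P.obj (fun _ : Unit => c) o) 0)
    (h : (P.obj (graft (fun _ : Bool => o) false fun _ : Unit => c) o).X 1)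
    (hh : ((P.obj (graft (fun _ : Bool => o) false fun _ : Unit => c) o).d 1 0).hom h =
      P.centrality μ e.1) :
    ((P.obj (twoColours c o) o).d 1 0).hom (P.symmComp h e.1) = 0 := by
  have h1 : ((P.obj (twoColours c o) o).d 1 0).hom (P.comp lastInput (graft_lastInput c o) o (add_zero 1) h e.1) =
      P.act (graftComm Unit Unit Bool.false_ne_true) (graft_comm _ Bool.false_ne_true _ _) o 0
        (P.comp (x := graft (fun _ : Bool => o) true fun _ : Unit => c)
          (.inl ⟨false, Bool.false_ne_true⟩) (graft_inl _ rfl _) o (zero_add 0)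
          (P.comp true rfl o (zero_add 0) μ e.1) e.1) -
      P.act outerSwapGraft (twoColours_outerSwapGraft c o) o 0
        (P.comp (x := graft (fun _ : Bool => o) true fun _ : Unit => c)
          (.inl ⟨false, Bool.false_ne_true⟩) (graft_inl _ rfl _) o (zero_add 0)
          (P.comp true rfl o (zero_add 0) μ e.1) e.1) := by
    rw [P.d_comp lastInput (graft_lastInput c o) (add_zero 1) (p' := 0) (q' := -1) (n' := 0) (by omega) (by omega)
      (by omega), hh, d_deg_zero, map_zero, smul_zero, add_zero, centrality, map_sub,
      LinearMap.sub_apply]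
    congr 1
    · have := P.comp_comm (x := fun _ : Bool => o) (c := o) (e := o) (y := o) false true
        Bool.false_ne_true rfl rfl (zero_add 0) (zero_add 0) (zero_add 0) (zero_add 0) μ e.1 e.1
      rw [mul_zero, Int.negOnePow_zero, one_smul] at this
      exact this
    · have := P.comp_act outerSwap (graft_outerSwap c o) (Equiv.refl Unit)
        (reindex_refl fun _ : Unit => c) (c := o) (y := o) lastInput rfl (zero_add 0)
        (P.comp true rfl o (zero_add 0) μ e.1) e.1
      rw [P.act_refl] at this
      exact this
  rw [symmComp, map_add, P.d_act _ _ (by omega), h1, map_sub, P.act_act, P.act_act]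
  simp only [innerSwap_trans_graftComm, innerSwap_trans_outerSwapGraft]
  abel

theorem comp_sub_mem_boundaries {I J : Type} [Finite I] [Finite J] {x : I → Col} {z : J → Col}
    {c y : Col} (i : I) (h : x i = c) {p q n : ℤ} (hn : p + q = n) {a a' : cycles (P.obj x y) p}
    {b b' : cycles (P.obj z c) q}
    (ha : (Submodule.Quotient.mk a : homology _ p) = Submodule.Quotient.mk a')
    (hb : (Submodule.Quotient.mk b : homology _ q) = Submodule.Quotient.mk b') :
    P.comp i h y hn a.1 b.1 - P.comp i h y hn a'.1 b'.1 ∈ boundaries (P.obj (graft x i z) y) n := by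
  have := congrArg₂ (fun a b => P.homologyComp i h y hn a b) ha hb
  simp only [homologyComp_mk] at this
  have h' := (Submodule.Quotient.eq _).1 this
  exact h'

theorem act_mem_boundaries {I I' : Type} [Finite I] [Finite I'] {x : I → Col} {x' : I' → Col}
    {y : Col} (σ : I' ≃ I) (hσ : ∀ s, x' s = x (σ s)) {n : ℤ} {a : (P.obj x y).X n}
    (ha : a ∈ boundaries (P.obj x y) n) : P.act σ hσ y n a ∈ boundaries (P.obj x' y) n := by
  obtain ⟨b, rfl⟩ := ha
  exact ⟨P.act σ hσ y (n + 1) b, P.d_act σ hσ rfl b⟩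

theorem centrality_sub_mem_boundaries {μ μ' : cycles (P.obj (fun _ : Bool => o) o) 0}
    {e e' : cycles (P.obj (fun _ : Unit => c) o) 0}
    (hμ : (Submodule.Quotient.mk μ : homology _ 0) = Submodule.Quotient.mk μ')
    (he : (Submodule.Quotient.mk e : homology _ 0) = Submodule.Quotient.mk e') :
    P.centrality μ.1 e.1 - P.centrality μ'.1 e'.1 ∈ boundaries (P.obj _ o) 0 := by
  have h1 := P.comp_sub_mem_boundaries false rfl (zero_add 0) hμ he
  have h2 := P.act_mem_boundaries outerSwap (graft_outerSwap c o)
    (P.comp_sub_mem_boundaries true rfl (zero_add 0) hμ he)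
  rw [map_sub] at h2
  have h3 := sub_mem h1 h2
  rw [centrality, centrality]
  convert h3 using 1
  abel

variable {P} {Q : DGOperad.{u, w} Col k}

theorem Hom.app_centrality (F : P.Hom Q) (μ : (P.obj (fun _ : Bool => o) o).X 0)
    (e : (P.obj (fun _ : Unit => c) o).X 0) :
    F.app _ o 0 (P.centrality μ e) = Q.centrality (F.app _ o 0 μ) (F.app _ o 0 e) := by
  rw [centrality, centrality, map_sub, F.app_act, F.app_comp, F.app_comp]

theorem Hom.app_symmComp (F : P.Hom Q)
    (h : (P.obj (graft (fun _ : Bool => o) false fun _ : Unit => c) o).X 1)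
    (e : (P.obj (fun _ : Unit => c) o).X 0) :
    F.app _ o 1 (P.symmComp h e) = Q.symmComp (F.app _ o 1 h) (F.app _ o 0 e) := by
  rw [symmComp, symmComp, map_add, F.app_act, F.app_comp]

theorem Hom.app_mem_cycles (F : P.Hom Q) {I : Type} [Finite I] {x : I → Col} {y : Col} {n : ℤ}
    (a : cycles (P.obj x y) n) : F.app x y n a.1 ∈ cycles (Q.obj x y) n := by
  rw [LinearMap.mem_ker, F.app_d x y (by omega), d_cycle _ (by omega), map_zero]

theorem Hom.IsQuasiIso.exists_lift {F : P.Hom Q} (hF : F.IsQuasiIso) {I : Type} [Finite I]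
    {x : I → Col} {y : Col} {n : ℤ} (b : cycles (Q.obj x y) n) :
    ∃ a : cycles (P.obj x y) n, (Submodule.Quotient.mk ⟨F.app x y n a.1, F.app_mem_cycles a⟩ :
      homology (Q.obj x y) n) = Submodule.Quotient.mk b := by
  obtain ⟨a, ha⟩ := (hF x y n).2 (Submodule.Quotient.mk b)
  obtain ⟨a, rfl⟩ := Submodule.Quotient.mk_surjective _ a
  exact ⟨a, ha⟩

theorem Hom.IsQuasiIso.mem_boundaries {F : P.Hom Q} (hF : F.IsQuasiIso) {I : Type} [Finite I]
    {x : I → Col} {y : Col} {n : ℤ} (a : cycles (P.obj x y) n)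
    (ha : F.app x y n a.1 ∈ boundaries (Q.obj x y) n) : a.1 ∈ boundaries (P.obj x y) n := by
  have h : (Submodule.Quotient.mk a : homology (P.obj x y) n) = 0 := by
    refine (hF x y n).1 ?_
    rw [map_zero]
    exact homology_mk_eq_zero ⟨F.app x y n a.1, F.app_mem_cycles a⟩ ha
  have h' := (Submodule.Quotient.mk_eq_zero _).1 h
  exact h'

/-- In a formal dg operad the Massey product of the classes of `e`, `μ` and `e` contains zero. The homotopy `h` can
be corrected by a cycle so that its image in the homology operad vanishes; then the cycle obtained
by symmetrizing `h ∘ e` maps to zero there, so it is a boundary. -/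
theorem exists_symmComp_mem_boundaries {C : DGOperad.{u, w} Col k} {γ : P.Hom C}
    {ψ : P.Hom C.homologyOperad} (hγ : γ.IsQuasiIso) (hψ : ψ.IsQuasiIso)
    (μ₀ : cycles (C.obj (fun _ : Bool => o) o) 0) (e₀ : cycles (C.obj (fun _ : Unit => c) o) 0)
    (h₀ : C.centrality μ₀.1 e₀.1 ∈ boundaries (C.obj _ o) 0) :
    ∃ (μ : cycles (C.obj (fun _ : Bool => o) o) 0) (e : cycles (C.obj (fun _ : Unit => c) o) 0)
      (h : (C.obj (graft (fun _ : Bool => o) false fun _ : Unit => c) o).X 1),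
      (Submodule.Quotient.mk μ : homology _ 0) = Submodule.Quotient.mk μ₀ ∧
      (Submodule.Quotient.mk e : homology _ 0) = Submodule.Quotient.mk e₀ ∧
      ((C.obj _ o).d 1 0).hom h = C.centrality μ.1 e.1 ∧
      C.symmComp h e.1 ∈ boundaries (C.obj (twoColours c o) o) 1 := by
  obtain ⟨μ, hμ⟩ := hγ.exists_lift μ₀
  obtain ⟨e, he⟩ := hγ.exists_lift e₀
  obtain ⟨h, hh⟩ : ∃ h, ((P.obj (graft (fun _ : Bool => o) false fun _ : Unit => c) o).d 1 0).hom h =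
      P.centrality μ.1 e.1 := by
    refine hγ.mem_boundaries ⟨P.centrality μ.1 e.1, ?_⟩ ?_
    · refine sub_mem (P.comp_mem_cycles false rfl o (zero_add 0) μ e) ?_
      exact P.act_mem_cycles _ _ _ _ ⟨_, P.comp_mem_cycles true rfl o (zero_add 0) μ e⟩
    · rw [γ.app_centrality]
      have := add_mem (C.centrality_sub_mem_boundaries hμ he) h₀
      rwa [sub_add_cancel] at this
  have hψh : ψ.app _ o 1 h ∈ cycles (C.homologyOperad.obj _ o) 1 := rfl
  obtain ⟨h', hh'⟩ := hψ.exists_lift ⟨_, hψh⟩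
  have hh'' : ψ.app _ o 1 h'.1 = ψ.app _ o 1 h := by
    obtain ⟨b, hb⟩ := (Submodule.Quotient.eq _).1 hh'
    exact (sub_eq_zero.1 (hb.symm.trans rfl))
  have hd : ((P.obj (graft (fun _ : Bool => o) false fun _ : Unit => c) o).d 1 0).hom (h - h'.1) =
      P.centrality μ.1 e.1 := by
    rw [map_sub, d_cycle _ (by omega), sub_zero]
    exact hh
  have hz : P.symmComp (h - h'.1) e.1 ∈ boundaries (P.obj (twoColours c o) o) 1 := by
    refine hψ.mem_boundaries ⟨_, mem_cycles_of (by omega) (P.d_symmComp _ e _ hd)⟩ ?_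
    rw [ψ.app_symmComp, map_sub, hh'', sub_self, symmComp, map_zero, LinearMap.zero_apply, map_zero,
      add_zero]
    exact zero_mem _
  refine ⟨⟨_, γ.app_mem_cycles μ⟩, ⟨_, γ.app_mem_cycles e⟩, γ.app _ o 1 (h - h'.1), hμ, he, ?_, ?_⟩
  · rw [γ.app_d _ _ (by omega), hd, γ.app_centrality]
  · rw [← γ.app_symmComp]
    obtain ⟨b, hb⟩ := hz
    exact ⟨γ.app _ o (1 + 1) b, by rw [γ.app_d _ _ rfl, hb]⟩

end DGOperad
end Operads

/-! ### Discs and semidiscs in the upper half-plane -/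

namespace SwissCheese

open Operads SingularChains Complex

theorem region_subset_ball (c : Colour) (p : ℂ × ℝ) : region c p ⊆ Metric.ball p.1 p.2 := by
  cases c with
  | closed => exact subset_rfl
  | opened => exact Set.sep_subset _ _

theorem disjoint_region_of_le_dist {c c' : Colour} {p q : ℂ × ℝ} (h : p.2 + q.2 ≤ dist p.1 q.1) :
    Disjoint (region c p) (region c' q) :=
  (Metric.ball_disjoint_ball h).mono (region_subset_ball c p) (region_subset_ball c' q)

theorem disc_subset_unit {p : ℂ × ℝ} (h : ‖p.1‖ + p.2 ≤ 1) (h' : p.2 ≤ p.1.im) :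
    region .closed p ⊆ region .opened (0, 1) := by
  intro u hu
  have hu' : ‖u - p.1‖ < p.2 := by simpa [region, dist_eq_norm] using hu
  refine ⟨?_, ?_⟩
  · rw [mem_ball_zero_iff]
    have := norm_add_le (u - p.1) p.1
    rw [sub_add_cancel] at this
    linarith
  · have h1 := (abs_le.1 (abs_im_le_norm (u - p.1))).1
    rw [sub_im] at h1
    linarith

theorem semidisc_subset_unit {p : ℂ × ℝ} (h : ‖p.1‖ + p.2 ≤ 1) :
    region .opened p ⊆ region .opened (0, 1) := by
  rintro u ⟨hu, hi⟩
  have hu' : ‖u - p.1‖ < p.2 := by simpa [dist_eq_norm] using hu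
  refine ⟨?_, hi⟩
  rw [mem_ball_zero_iff]
  have := norm_add_le (u - p.1) p.1
  rw [sub_add_cancel] at this
  linarith

/-- A point of the upper half-plane outside a semidisc is not vertically below a point of the
semidisc. -/
theorem neg_I_mul_sub_mem_slitPlane {p : ℂ × ℝ} (hp : p.1.im = 0) {c w : ℂ} (hc : 0 < c.im)
    (hcp : c ∉ region .opened p) (hw : w ∈ region .opened p) : -I * (c - w) ∈ slitPlane := by
  rw [mem_slitPlane_iff]
  by_contra! h
  obtain ⟨h1, h2⟩ := h
  simp only [mul_re, mul_im, neg_re, neg_im, I_re, I_im, sub_re, sub_im] at h1 h2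
  refine hcp ⟨?_, hc⟩
  refine lt_of_le_of_lt ?_ (Metric.mem_ball.1 hw.1)
  rw [dist_eq_re_im, dist_eq_re_im, hp]
  refine Real.sqrt_le_sqrt ?_
  have h3 : c.re = w.re := by linarith
  rw [h3]
  nlinarith

theorem add_radius_le_of_disjoint {p q : ℂ × ℝ} (hp : p.1.im = 0) (hq : q.1.im = 0)
    (hp2 : 0 < p.2) (hq2 : 0 < q.2) (h : Disjoint (region .opened p) (region .opened q)) :
    p.2 + q.2 ≤ dist p.1 q.1 := by
  by_contra! hlt
  -- The balls meet in the point of the real line that divides the segment of the centres in the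
  -- ratio of the radii; a point slightly above it lies in both semidiscs.
  let x : ℂ := ((p.2 + q.2)⁻¹ : ℝ) * (q.2 * p.1 + p.2 * q.1)
  have hs : (p.2 : ℂ) + q.2 ≠ 0 := by exact_mod_cast (add_pos hp2 hq2).ne'
  have hx1 : x - p.1 = ((p.2 / (p.2 + q.2) : ℝ) : ℂ) * (q.1 - p.1) := by
    simp only [x]
    push_cast
    field_simp
    ring
  have hx2 : x - q.1 = ((q.2 / (p.2 + q.2) : ℝ) : ℂ) * (p.1 - q.1) := by
    simp only [x]
    push_cast
    field_simp
    ring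
  have hxp : x ∈ Metric.ball p.1 p.2 := by
    rw [mem_ball_iff_norm, hx1, norm_mul, norm_real, Real.norm_of_nonneg (by positivity),
      ← dist_eq_norm, dist_comm, div_mul_eq_mul_div, div_lt_iff₀ (by positivity)]
    exact mul_lt_mul_of_pos_left hlt hp2
  have hxq : x ∈ Metric.ball q.1 q.2 := by
    rw [mem_ball_iff_norm, hx2, norm_mul, norm_real, Real.norm_of_nonneg (by positivity),
      ← dist_eq_norm, div_mul_eq_mul_div, div_lt_iff₀ (by positivity)]
    exact mul_lt_mul_of_pos_left hlt hq2
  have hxi : x.im = 0 := by simp [x, hp, hq]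
  obtain ⟨δ, hδ, hb⟩ := Metric.isOpen_iff.1 (Metric.isOpen_ball.inter Metric.isOpen_ball) x
    ⟨hxp, hxq⟩
  have hy : x + (δ / 2 : ℝ) * I ∈ Metric.ball x δ := by
    rw [mem_ball_iff_norm, add_sub_cancel_left, norm_mul, norm_real, norm_I, mul_one,
      Real.norm_of_nonneg (by positivity)]
    linarith
  have hi : 0 < (x + (δ / 2 : ℝ) * I).im := by
    simp [hxi, hδ]
  exact Set.disjoint_left.1 h ⟨(hb hy).1, hi⟩ ⟨(hb hy).2, hi⟩

theorem re_lt_re_of_disjoint {p q : ℂ × ℝ} (hp : p.1.im = 0) (hq : q.1.im = 0)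
    (hp2 : 0 < p.2) (hq2 : 0 < q.2) (h : Disjoint (region .opened p) (region .opened q))
    (hpq : p.1.re ≤ q.1.re) {w w' : ℂ} (hw : w ∈ region .opened p) (hw' : w' ∈ region .opened q) :
    w.re < w'.re := by
  have h1 := add_radius_le_of_disjoint hp hq hp2 hq2 h
  have h2 : dist p.1 q.1 = q.1.re - p.1.re := by
    rw [dist_of_im_eq (hp.trans hq.symm), Real.dist_eq, abs_sub_comm, abs_of_nonneg (by linarith)]
  have h3 := (abs_le.1 ((abs_re_le_norm (w - p.1)))).2
  have h4 := (abs_le.1 ((abs_re_le_norm (w' - q.1)))).1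
  have h5 := mem_ball_iff_norm.1 hw.1
  have h6 := mem_ball_iff_norm.1 hw'.1
  rw [sub_re] at h3 h4
  linarith

theorem IsConfiguration.centre_mem_region {I : Type} {x : I → Colour} {y : Colour} {f : I → ℂ × ℝ}
    (hf : IsConfiguration x y f) {i : I} (hi : x i = .closed) : (f i).1 ∈ region y (0, 1) := by
  refine hf.region_subset i ?_
  rw [hi]
  exact Metric.mem_ball_self (hf.radius_pos i)

theorem place_mem_region {p q : ℂ × ℝ} (hp : 0 < p.2) (hp' : p.1.im = 0)
    (hq : q.1 ∈ region .opened (0, 1)) : (place p q).1 ∈ region .opened p := by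
  have h := (mem_region_place (q := (0, 1)) (c := .opened) hp (fun _ => hp') q.1).2 hq
  rwa [place_unit] at h

/-! ### The winding number of two discs and the order of two semidiscs -/

/-- Two semidiscs in the unit semidisc. -/
abbrev Semidiscs : Type := Configuration (fun _ : Bool => Colour.opened) .opened

/-- One disc in the unit semidisc. -/
abbrev Disc : Type := Configuration (fun _ : Unit => Colour.closed) .opened

/-- A disc (with the label `.inr ()`) and a semidisc (with the label `lastInput`) in the unit
semidisc. -/
abbrev DiscAndSemidisc : Type :=
  Configuration (graft (fun _ : Bool => Colour.opened) false fun _ : Unit => .closed) .opened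

/-- Two discs in the unit semidisc. -/
abbrev TwoDiscs : Type := Configuration (twoColours Colour.closed .opened) .opened

/-- The difference of the centres of two discs, rotated clockwise by a right angle, so that the cut
of the principal logarithm corresponds to the first disc being vertically below the second. -/
def separation : C(TwoDiscs, ℂ) where
  toFun f := -I * ((f.1 firstOfTwo).1 - (f.1 (.inr ())).1)
  continuous_toFun := by
    have h : ∀ s, Continuous fun f : TwoDiscs => (f.1 s).1 := fun s =>
      continuous_fst.comp ((continuous_apply s).comp continuous_subtype_val)
    exact continuous_const.mul ((h _).sub (h _))

theorem separation_ne_zero (f : TwoDiscs) : separation f ≠ 0 := by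
  have hr := f.2.radius_pos
  refine mul_ne_zero (neg_ne_zero.2 I_ne_zero) (sub_ne_zero.2 fun h => ?_)
  have hd : Disjoint (Metric.ball _ _) (Metric.ball _ _) :=
    f.2.nonoverlapping firstOfTwo (.inr ()) Sum.inl_ne_inr
  refine Set.disjoint_left.1 hd (Metric.mem_ball_self (hr _)) ?_
  rw [h]
  exact Metric.mem_ball_self (hr _)

/-- Insertion of a disc into the semidisc of a configuration. -/
abbrev insertDisc : C(DiscAndSemidisc × Disc, TwoDiscs) :=
  swissCheese.comp lastInput (graft_lastInput _ _) .opened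

/-- The exchange of the labels of two discs. -/
abbrev exchange : C(TwoDiscs, TwoDiscs) :=
  swissCheese.act innerSwap (twoColours_innerSwap _ _) .opened

/-- Insertion of a disc into the first of two semidiscs. -/
abbrev insertFirst : C(Semidiscs × Disc, DiscAndSemidisc) := swissCheese.comp false rfl .opened

/-- Insertion of a disc into the second of two semidiscs. -/
abbrev insertSecond : C(Semidiscs × Disc, DiscAndSemidisc) :=
  ContinuousMap.comp (swissCheese.act outerSwap (graft_outerSwap _ _) .opened)
    (swissCheese.comp true rfl .opened)

theorem separation_exchange (f : TwoDiscs) : separation (exchange f) = -separation f := by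
  change -I * ((f.1 (.inr ())).1 - (f.1 firstOfTwo).1) =
    -(-I * ((f.1 firstOfTwo).1 - (f.1 (.inr ())).1))
  ring

theorem separation_insertDisc (u : DiscAndSemidisc × Disc) :
    separation (insertDisc u) = -I * ((u.1.1 (.inr ())).1 -
      (place (u.1.1 lastInput) (u.2.1 ())).1) := rfl

theorem separation_insertDisc_mem_slitPlane (u : DiscAndSemidisc × Disc) :
    separation (insertDisc u) ∈ slitPlane := by
  obtain ⟨⟨f, hf⟩, ⟨g, hg⟩⟩ := u
  have hp := hf.centre_real lastInput rfl
  refine neg_I_mul_sub_mem_slitPlane hp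
    (hf.centre_mem_region (i := .inr ()) rfl).2 (fun h => ?_)
    (place_mem_region (hf.radius_pos _) hp (hg.centre_mem_region rfl))
  exact Set.disjoint_left.1 (hf.nonoverlapping (.inr ()) lastInput Sum.inr_ne_inl)
    (Metric.mem_ball_self (hf.radius_pos _)) h

/-- `1` if the first semidisc is on the left of the second one, and `-1` otherwise. -/
def order (m : Semidiscs) : ℤ := if (m.1 false).1.re < (m.1 true).1.re then 1 else -1

theorem re_place_lt {m : Semidiscs} {i j : Bool} (hij : i ≠ j)
    (h : (m.1 i).1.re ≤ (m.1 j).1.re) (v v' : Disc) :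
    (place (m.1 i) (v.1 ())).1.re < (place (m.1 j) (v'.1 ())).1.re :=
  re_lt_re_of_disjoint (m.2.centre_real i rfl) (m.2.centre_real j rfl) (m.2.radius_pos i)
    (m.2.radius_pos j) (m.2.nonoverlapping i j hij) h
    (place_mem_region (m.2.radius_pos i) (m.2.centre_real i rfl) (v.2.centre_mem_region rfl))
    (place_mem_region (m.2.radius_pos j) (m.2.centre_real j rfl) (v'.2.centre_mem_region rfl))

theorem re_ne_re (m : Semidiscs) : (m.1 false).1.re ≠ (m.1 true).1.re := by
  intro h
  have h1 := add_radius_le_of_disjoint (m.2.centre_real false rfl) (m.2.centre_real true rfl)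
    (m.2.radius_pos _) (m.2.radius_pos _) (m.2.nonoverlapping false true Bool.false_ne_true)
  rw [dist_of_re_eq h, m.2.centre_real false rfl, m.2.centre_real true rfl, dist_self] at h1
  have := m.2.radius_pos false
  have := m.2.radius_pos true
  linarith

theorem branch_sub_branch (m : Semidiscs) (v v' : Disc) :
    branch (separation (exchange (insertDisc (insertFirst (m, v), v')))) -
      branch (separation (exchange (insertDisc (insertSecond (m, v), v')))) = order m := by
  have e1 : (separation (exchange (insertDisc (insertFirst (m, v), v')))).im =
      (place (m.1 false) (v.1 ())).1.re - (place (m.1 true) (v'.1 ())).1.re := by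
    rw [separation_exchange, separation_insertDisc]
    change (-(-I * ((place (m.1 false) (v.1 ())).1 - (place (m.1 true) (v'.1 ())).1))).im = _
    simp
  have e2 : (separation (exchange (insertDisc (insertSecond (m, v), v')))).im =
      (place (m.1 true) (v.1 ())).1.re - (place (m.1 false) (v'.1 ())).1.re := by
    rw [separation_exchange, separation_insertDisc]
    change (-(-I * ((place (m.1 true) (v.1 ())).1 - (place (m.1 false) (v'.1 ())).1))).im = _
    simp
  rw [branch, branch, e1, e2, order]
  rcases lt_or_gt_of_ne (re_ne_re m) with h | h
  · have h1 := re_place_lt Bool.false_ne_true h.le v v'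
    have h2 := re_place_lt Bool.false_ne_true h.le v' v
    rw [if_neg (by linarith), if_pos (by linarith), if_pos h]
    rfl
  · have h1 := re_place_lt Bool.false_ne_true.symm h.le v v'
    have h2 := re_place_lt Bool.false_ne_true.symm h.le v' v
    rw [if_pos (by linarith), if_neg (by linarith), if_neg h.not_gt]
    rfl

theorem order_eq_of_path (s : C(Simplex 1, Semidiscs)) (p q : Simplex 1) :
    order (s p) = order (s q) := by
  have hc : ∀ i, Continuous fun p => ((s p).1 i).1.re := fun i => continuous_re.comp
    (continuous_fst.comp ((continuous_apply i).comp (continuous_subtype_val.comp s.continuous)))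
  have key : ∀ p q : Simplex 1, ((s p).1 false).1.re < ((s p).1 true).1.re →
      ((s q).1 false).1.re < ((s q).1 true).1.re := by
    intro p q hp
    by_contra! hq
    obtain ⟨r, hr⟩ := mem_range_of_exists_le_of_exists_ge
      (f := fun p => ((s p).1 false).1.re - ((s p).1 true).1.re) ((hc _).sub (hc _)) (c := 0)
      ⟨p, by linarith⟩ ⟨q, by linarith⟩
    exact re_ne_re (s r) (sub_eq_zero.1 hr)
  simp only [order, show (((s p).1 false).1.re < ((s p).1 true).1.re) ↔
    ((s q).1 false).1.re < ((s q).1 true).1.re from ⟨key p q, key q p⟩]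

/-! ### Basic configurations -/

/-- Two semidiscs, the first one on the left. -/
def leftRight : Semidiscs where
  val i := (if i then 1 / 2 else -1 / 2, 1 / 4)
  property := by
    refine ⟨⟨false⟩, nofun, fun _ => by norm_num, ?_, ?_, ?_⟩
    · rintro (_ | _) - <;> norm_num
    · rintro (_ | _) <;> exact semidisc_subset_unit (by norm_num)
    · rintro (_ | _) (_ | _) h
      · exact (h rfl).elim
      · exact disjoint_region_of_le_dist (by norm_num [dist_eq_norm])
      · exact disjoint_region_of_le_dist (by norm_num [dist_eq_norm])
      · exact (h rfl).elim

theorem order_leftRight : order leftRight = 1 := by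
  norm_num [order, leftRight]

/-- A disc in the unit semidisc. -/
def midDisc : Disc where
  val _ := (I / 2, 1 / 4)
  property := by
    refine ⟨⟨()⟩, nofun, fun _ => by norm_num, nofun, ?_, ?_⟩
    · intro _
      exact disc_subset_unit (by norm_num) (by norm_num)
    · exact fun _ _ h => (h rfl).elim

theorem isConfiguration_over (t : ℝ) (h0 : 0 ≤ t) (h1 : t ≤ 1) :
    IsConfiguration (graft (fun _ : Bool => Colour.opened) false fun _ : Unit => .closed) .opened
      (Sum.elim (fun _ => ((1 / 2 - t : ℝ), 1 / 4)) fun _ =>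
        (⟨t - 1 / 2, 1 / 8 + 2 * (t * (1 - t))⟩, 1 / 16)) := by
  have hs : 0 ≤ t * (1 - t) := mul_nonneg h0 (by linarith)
  have hs' : t * (1 - t) ≤ 1 / 4 := by nlinarith [sq_nonneg (t - 1 / 2)]
  have hd : (1 / 16 : ℝ) + 1 / 4 ≤
      dist (⟨t - 1 / 2, 1 / 8 + 2 * (t * (1 - t))⟩ : ℂ) ((1 / 2 - t : ℝ) : ℂ) := by
    rw [dist_eq_re_im]
    refine Real.le_sqrt_of_sq_le ?_
    simp only [ofReal_re, ofReal_im]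
    nlinarith
  refine ⟨⟨.inr ()⟩, nofun, ?_, ?_, ?_, ?_⟩
  · rintro (_ | _) <;> norm_num
  · rintro (_ | _) h
    · exact ofReal_im _
    · cases h
  · rintro (_ | _)
    · refine semidisc_subset_unit ?_
      simp only [Sum.elim_inl, norm_real, Real.norm_eq_abs]
      have : |1 / 2 - t| ≤ 1 / 2 := abs_le.2 ⟨by linarith, by linarith⟩
      linarith
    · refine disc_subset_unit ?_ ?_
      · have : ‖(⟨t - 1 / 2, 1 / 8 + 2 * (t * (1 - t))⟩ : ℂ)‖ ≤ 15 / 16 := by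
          refine abs_le_of_sq_le_sq' ?_ (by norm_num) |>.2
          rw [Complex.sq_norm, normSq_apply]
          nlinarith
        simp only [Sum.elim_inr]
        linarith
      · simp only [Sum.elim_inr]
        linarith
  · rintro (⟨_ | _, h⟩ | _) (⟨_ | _, h'⟩ | _) hne
    · exact (h rfl).elim
    · exact (h rfl).elim
    · exact (h rfl).elim
    · exact (h' rfl).elim
    · exact (hne rfl).elim
    · refine disjoint_region_of_le_dist ?_
      rw [add_comm, dist_comm]
      exact hd
    · exact (h' rfl).elim
    · exact disjoint_region_of_le_dist hd
    · exact (hne rfl).elim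

/-- A disc can be moved over a semidisc from its left to its right. -/
theorem joined_insertSecond_insertFirst :
    Joined (insertSecond (leftRight, midDisc)) (insertFirst (leftRight, midDisc)) := by
  refine Joined.symm ⟨⟨⟨fun t => ⟨_, isConfiguration_over t t.2.1 t.2.2⟩, ?_⟩, ?_, ?_⟩⟩
  · refine Continuous.subtype_mk (continuous_pi ?_) _
    rintro (_ | _)
    · simp only [Sum.elim_inl]
      fun_prop
    · simp only [Sum.elim_inr]
      refine Continuous.prodMk ?_ continuous_const
      have : (fun t : unitInterval => (⟨t - 1 / 2, 1 / 8 + 2 * (t * (1 - t))⟩ : ℂ)) =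
          fun t : unitInterval => ((t - 1 / 2 : ℝ) : ℂ) +
            ((1 / 8 + 2 * (t * (1 - t)) : ℝ) : ℂ) * I := by
        funext t
        exact mk_eq_add_mul_I _ _
      rw [this]
      fun_prop
  · refine Subtype.ext (funext ?_)
    rintro (⟨_ | _, h⟩ | _)
    · exact (h rfl).elim
    · change (_, _) = ((1 / 2 : ℂ), (1 / 4 : ℝ))
      norm_num
    · change (_, _) = place (-1 / 2, 1 / 4) (I / 2, 1 / 4)
      refine Prod.ext (Complex.ext ?_ ?_) ?_ <;> norm_num [place]
  · refine Subtype.ext (funext ?_)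
    rintro (⟨_ | _, h⟩ | _)
    · exact (h rfl).elim
    · change (_, _) = ((-1 / 2 : ℂ), (1 / 4 : ℝ))
      norm_num
    · change (_, _) = place (1 / 2, 1 / 4) (I / 2, 1 / 4)
      refine Prod.ext (Complex.ext ?_ ?_) ?_ <;> norm_num [place]

end SwissCheese

/-! ### The chains of the Swiss-cheese operad -/

namespace SwissCheese

open Operads SingularChains DGOperad

variable {k : Type u} [CommRing k]

theorem mem_boundaries_iff {X : Type} [TopologicalSpace X] {n : ℤ} {c : chains k X n} :
    c ∈ boundaries (singularComplex k X) n ↔ ∃ b ∈ chains k X (n + 1), diff b = c.1 := by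
  constructor
  · rintro ⟨b, hb⟩
    refine ⟨b.1, b.2, ?_⟩
    exact congrArg Subtype.val ((singularComplex_d rfl b).symm.trans hb)
  · rintro ⟨b, hb, e⟩
    refine ⟨(⟨b, hb⟩ : chains k X (n + 1)), ?_⟩
    exact (singularComplex_d rfl _).trans (Subtype.ext e)

theorem pointChain_mem_cycles {X : Type} [TopologicalSpace X] (u : X) :
    pointChain k u ∈ cycles (singularComplex k X) 0 := by
  refine mem_cycles_of (n := -1) (by norm_num) ?_
  exact (singularComplex_d (by norm_num) _).trans
    (Subtype.ext (diff_of_mem_chains_zero (pointChain k u).2))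

theorem cochainZero_eq_of_homologous {X : Type} [TopologicalSpace X] {f : X → k}
    (hf : ∀ s : C(Simplex 1, X), f (s (vert 1)) = f (s (vert 0)))
    {a b : cycles (singularComplex k X) 0}
    (hab : (Submodule.Quotient.mk a : homology (singularComplex k X) 0) = Submodule.Quotient.mk b) :
    cochainZero f a.1.1 = cochainZero f b.1.1 := by
  have h := (Submodule.Quotient.eq _).1 hab
  obtain ⟨c, hc, e⟩ := mem_boundaries_iff.1 h
  rw [← sub_eq_zero, ← map_sub]
  exact (congrArg (cochainZero f) e.symm).trans (cochainZero_diff hf hc)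

theorem centrality_coe (μ : chains k Semidiscs 0) (e : chains k Disc 0) :
    Subtype.val (p := (· ∈ chains k DiscAndSemidisc 0)) ((swissCheese.chainOperad k).centrality
      (c := Colour.closed) (o := Colour.opened) μ e) =
      push insertFirst (cross μ.1 e.1) - push insertSecond (cross μ.1 e.1) :=
  congrArg (push insertFirst (cross μ.1 e.1) - ·) <|
    push_push (X := Semidiscs × Disc) (Z := DiscAndSemidisc)
      (Y := Configuration (graft (fun _ : Bool => Colour.opened) true fun _ : Unit => .closed) .opened)
      (swissCheese.comp (x := fun _ => .opened) (z := fun _ => .closed) true rfl .opened)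
      (swissCheese.act outerSwap (graft_outerSwap _ _) .opened)
      (cross μ.1 e.1)

theorem centrality_mem_boundaries :
    (swissCheese.chainOperad k).centrality (c := Colour.closed) (o := Colour.opened)
      (pointChain k leftRight) (pointChain k midDisc) ∈
      boundaries ((swissCheese.chainOperad k).obj
        (graft (fun _ : Bool => Colour.opened) false fun _ : Unit => .closed) .opened) 0 := by
  obtain ⟨c, hc, e⟩ := joined_pointChain (k := k) joined_insertSecond_insertFirst
  refine mem_boundaries_iff.2 ⟨c, hc, e.trans (Eq.trans ?_ (centrality_coe _ _).symm)⟩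
  exact (congrArg₂ (· - ·) (push_cross_pointChain insertFirst leftRight midDisc)
    (push_cross_pointChain insertSecond leftRight midDisc)).symm

/-- The winding number of the symmetrization of `h ∘ e`. The separation of the two discs in `h ∘ e`
avoids the cut, and after the exchange of the discs it avoids the opposite ray; so only the end
points of `h` contribute, where the sides are determined by the order of the semidiscs. -/
theorem windCochain_symmComp {μ : chains k Semidiscs 0} {e : chains k Disc 0}
    {h : chains k DiscAndSemidisc 1}
    (hh : diff h.1 = push insertFirst (cross μ.1 e.1) - push insertSecond (cross μ.1 e.1)) :
    windCochain k separation
      (push insertDisc (cross h.1 e.1) + push exchange (push insertDisc (cross h.1 e.1))) =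
      cochainZero (fun m => (order m : k)) μ.1 * cochainZero (fun _ => 1) e.1 *
        cochainZero (fun _ => 1) e.1 := by
  have hc : cross h.1 e.1 ∈ chains k (DiscAndSemidisc × Disc) 1 := cross_mem (add_zero 1) h.2 e.2
  have hme : cross μ.1 e.1 ∈ chains k (Semidiscs × Disc) 0 := cross_mem (add_zero 0) μ.2 e.2
  have hmee : cross (cross μ.1 e.1) e.1 ∈ chains k ((Semidiscs × Disc) × Disc) 0 :=
    cross_mem (add_zero 0) hme e.2
  have hd : diff (cross h.1 e.1) =
      push (insertFirst.prodMap (.id Disc)) (cross (cross μ.1 e.1) e.1) -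
        push (insertSecond.prodMap (.id Disc)) (cross (cross μ.1 e.1) e.1) := by
    rw [diff_cross h.2, diff_of_mem_chains_zero e.2, map_zero, smul_zero, add_zero, hh, map_sub,
      LinearMap.sub_apply, cross_push_left, cross_push_left]
  rw [map_add, windCochain_push _ _ hc, push_push, windCochain_push _ _ hc,
    windCochain_of_slitPlane separation_insertDisc_mem_slitPlane hc, zero_add,
    windCochain_of_neg_slitPlane (fun u => ?_) hc, hd, map_sub, cochainZero_push _ _ hmee,
    cochainZero_push _ _ hmee, cochainZero_sub _ _ hmee, ← cochainZero_cross _ _ μ.2 e.2,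
    ← cochainZero_cross _ _ hme e.2]
  · congr 1
    refine congrArg _ (funext fun u => ?_)
    obtain ⟨⟨m, v⟩, v'⟩ := u
    have := congrArg (Int.cast : ℤ → k) (branch_sub_branch m v v')
    rw [Int.cast_sub] at this
    rw [mul_one, mul_one]
    exact this
  · have := separation_insertDisc_mem_slitPlane u
    rw [ContinuousMap.comp_apply, ContinuousMap.comp_apply, separation_exchange, neg_neg]
    exact this

/-- The chains that the vanishing of the Massey product provides if the operad is formal. -/
theorem exists_chains_of_isFormal (hf : TopOperad.IsFormal.{u, v} swissCheese k) :
    ∃ (μ : chains k Semidiscs 0) (e : chains k Disc 0) (h : chains k DiscAndSemidisc 1),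
      cochainZero (fun m => (order m : k)) μ.1 = 1 ∧ cochainZero (fun _ => (1 : k)) e.1 = 1 ∧
      diff h.1 = push insertFirst (cross μ.1 e.1) - push insertSecond (cross μ.1 e.1) ∧
      ∃ b ∈ chains k TwoDiscs 2, diff b =
        push insertDisc (cross h.1 e.1) + push exchange (push insertDisc (cross h.1 e.1)) := by
  obtain ⟨P, γ, ψ, hγ, hψ⟩ := hf
  obtain ⟨μ, e, h, hμ, he, hh, hb⟩ := DGOperad.exists_symmComp_mem_boundaries
    (c := Colour.closed) (o := Colour.opened) hγ hψ
    ⟨pointChain k leftRight, pointChain_mem_cycles _⟩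
    ⟨pointChain k midDisc, pointChain_mem_cycles _⟩ centrality_mem_boundaries
  refine ⟨μ.1, e.1, h, ?_, ?_, ?_, mem_boundaries_iff.1 hb⟩
  · exact (cochainZero_eq_of_homologous (X := Semidiscs)
      (fun s => congrArg Int.cast (order_eq_of_path s _ _)) hμ).trans
      ((cochainZero_single _ _).trans ((congrArg Int.cast order_leftRight).trans Int.cast_one))
  · exact (cochainZero_eq_of_homologous (X := Disc) (fun s => rfl) he).trans
      (cochainZero_single _ _)
  · have h1 := congrArg (Subtype.val (p := (· ∈ chains k DiscAndSemidisc 0)))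
      ((singularComplex_d (zero_add 1) h).symm.trans hh)
    exact h1.trans (centrality_coe μ.1 e.1)

end SwissCheese

theorem theorem1 (k : Type u) [Field k] :
    ¬ Operads.TopOperad.IsFormal.{u, v} SwissCheese.swissCheese k := by
  intro hf
  obtain ⟨μ, e, h, hμ, he, hd, b, hb, hb'⟩ := SwissCheese.exists_chains_of_isFormal hf
  have h0 := SingularChains.windCochain_diff (k := k) SwissCheese.separation_ne_zero hb
  rw [hb', SwissCheese.windCochain_symmComp hd, hμ, he, one_mul, one_mul] at h0
  exact one_ne_zero h0

end
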